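/- Let $\Gamma$ be a finite, connected, simple graph with vertex set $X$, path-length distance $\partial$ and diameter $d\ge 3$. Assume that $\Gamma$ is distance-regular: for all $0\le h,i,j\le d$ and all $x,y\in X$ with $\partial(x,y)=h$, the number $p^h_{ij}$ of $z\in X$ with $\partial(x,z)=i$ and $\partial(y,z)=j$ depends only on $h,i,j$. Put $a_i=p^i_{1i}$ $(0\le i\le d)$, $b_i=p^i_{1,i+1}$ $(0\le i\le d-1)$, let $k=b_0$ be the valency, and let $\theta_0>\theta_1>\cdots>\theta_d$ be the distinct eigenvalues of the adjacency matrix of $\Gamma$. Assume that $\Gamma$ is tight, that is, $\Gamma$ is not bipartite (some $a_i$ is nonzero) and $$\Bigl(\theta_1+\frac{k}{a_1+1}\Bigr)\Bigl(\theta_d+\frac{k}{a_1+1}\Bigr)=-\frac{k a_1 b_1}{(a_1+1)^2}.$$ Let $\theta\in\{\theta_1,\theta_d\}$, let $\theta'$ be the other element of $\{\theta_1,\theta_d\}$, and put $$\varepsilon=\frac{k^2-\theta\theta'}{k(\theta-\theta')}.$$ Let $E$ be the primitive idempotent associated with $\theta$ (the matrix of the orthogonal projection of $\mathbb R^X$ onto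 the $\theta$-eigenspace of the adjacency matrix), let $m=\operatorname{rank}E$, and let $\sigma_0,\dots,\sigma_d$ be the cosine sequence of $\theta$, that is, the real numbers with $E=|X|^{-1}m\sum_{i=0}^d\sigma_iA_i$, where $A_i$ is the $i$th distance matrix of $\Gamma$ (the $0/1$ matrix whose $x,y$ entry is $1$ if and only if $\partial(x,y)=i$). Write $\sigma=\sigma_1$. Let $x\in X$ and let $\Delta=\Delta(x)$ be the local graph of $x$, that is, the subgraph of $\Gamma$ induced on the set of neighbours of $x$. Then the denominators in the formulas below are nonzero, and (i)–(iv) hold. (i) $\Delta$ is strongly regular with parameters $(k,a_1,\lambda,\mu)$: it has $k$ vertices, it is regular with valency $a_1$, any two adjacent vertices of $\Delta$ have exactly $\lambda$ common neighbours in $\Delta$, and any two distinct non-adjacent vertices of $\Delta$ have exactly $\mu$ common neighbours in $\Delta$, where $$a_1=-\frac{(1-\sigma_2)(1+\sigma)(1-\varepsilon)}{(\sigma-\sigma_2)(1-\varepsilon\sigma)},$$ $$\lambda=a_1\frac{2\sigma}{1+\sigma}-a_1\frac{1-\sigma}{1+\sigma}\,\frac{\sigma_2}{\sigma-\sigma_2}-\frac{1-\sigma_2}{\sigma-\sigma_2},\qquad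 \mu=\frac{a_1}{1+\sigma}\,\frac{\sigma^2-\sigma_2}{\sigma-\sigma_2}.$$ (ii) $\Delta$ is connected and not a clique. (iii) The adjacency matrix of $\Delta$ has exactly three distinct eigenvalues, namely $a_1$, $r$, $s$, where $$r=\frac{a_1\sigma}{1+\sigma},\qquad s=-\frac{1-\sigma_2}{\sigma-\sigma_2}.$$ (iv) The multiplicities of $r$ and $s$ as eigenvalues of $\Delta$ are $$\operatorname{mult}_r=\frac{(1+\sigma)(\sigma-\varepsilon)}{\sigma_2-\sigma^2},\qquad \operatorname{mult}_s=-\frac{(1-\varepsilon)(1+\sigma)(\sigma_2-\varepsilon\sigma)}{(\sigma_2-\sigma^2)(1-\varepsilon\sigma)}.$$ -/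

import Mathlib

namespace DistReg

variable {X : Type*} [Fintype X]

/-- The number of vertices at distance `i` from `x` and at distance `j` from `y`. -/
noncomputable def cellCard (G : SimpleGraph X) (i j : ℕ) (x y : X) : ℕ :=
  (Finset.univ.filter fun z : X => G.dist x z = i ∧ G.dist y z = j).card

/-- A finite connected graph is distance-regular when, for all `h, i, j` from `0` to the diameter,
the number of vertices at distance `i` from `x` and `j` from `y` is the same for all pairs
`x, y` at distance `h`. -/
structure IsDistanceRegular (G : SimpleGraph X) : Prop where
  connected : G.Connected
  cellCard_eq : ∀ h i j : ℕ, h ≤ G.diam → i ≤ G.diam → j ≤ G.diam →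
    ∀ x y x' y' : X, G.dist x y = h → G.dist x' y' = h →
      cellCard G i j x y = cellCard G i j x' y'

open Classical in
/-- The intersection number `p^h_{ij}`: the common value of `cellCard G i j x y` over the pairs
`x, y` at distance `h` (and `0` when there is no such pair). -/
noncomputable def intersectionNumber (G : SimpleGraph X) (h i j : ℕ) : ℕ :=
  if H : ∃ p : X × X, G.dist p.1 p.2 = h then cellCard G i j H.choose.1 H.choose.2 else 0

/-- The intersection numbers do not depend on the pair chosen in their definition. -/
theorem IsDistanceRegular.cellCard_eq_intersectionNumber {G : SimpleGraph X}
    (hG : IsDistanceRegular G) {h i j : ℕ} (hh : h ≤ G.diam) (hi : i ≤ G.diam) (hj : j ≤ G.diam)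
    {x y : X} (hxy : G.dist x y = h) : cellCard G i j x y = intersectionNumber G h i j := by
  have H : ∃ p : X × X, G.dist p.1 p.2 = h := ⟨(x, y), hxy⟩
  rw [intersectionNumber, dif_pos H]
  exact hG.cellCard_eq h i j hh hi hj _ _ _ _ hxy H.choose_spec

/-- `a_i = p^i_{1 i}`. -/
noncomputable def a (G : SimpleGraph X) (i : ℕ) : ℕ := intersectionNumber G i 1 i

/-- `b_i = p^i_{1,i+1}`. -/
noncomputable def b (G : SimpleGraph X) (i : ℕ) : ℕ := intersectionNumber G i 1 (i + 1)

/-- The valency `k = b_0`. -/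
noncomputable def valency (G : SimpleGraph X) : ℕ := b G 0

/-- A distance-regular graph is bipartite when `a_i = 0` for `0 ≤ i ≤ d`. -/
def Bipartite (G : SimpleGraph X) : Prop := ∀ i ≤ G.diam, a G i = 0

variable [DecidableEq X]

/-- `θ 0 > θ 1 > ⋯ > θ d` are all the (distinct) eigenvalues of the adjacency matrix, where
`d` is the diameter. -/
def IsEigenvalueSequence (G : SimpleGraph X) [DecidableRel G.Adj] (θ : ℕ → ℝ) : Prop :=
  StrictAntiOn θ (Set.Iic G.diam) ∧ θ '' Set.Iic G.diam = spectrum ℝ (G.adjMatrix ℝ)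

/-- A distance-regular graph is tight when it is not bipartite and equality holds in the
fundamental bound
`(θ₁ + k / (a₁ + 1)) (θ_d + k / (a₁ + 1)) ≥ - k a₁ b₁ / (a₁ + 1) ^ 2`. -/
def IsTight (G : SimpleGraph X) [DecidableRel G.Adj] : Prop :=
  ¬ Bipartite G ∧ ∃ θ : ℕ → ℝ, IsEigenvalueSequence G θ ∧
    (θ 1 + (valency G : ℝ) / ((a G 1 : ℝ) + 1)) *
        (θ G.diam + (valency G : ℝ) / ((a G 1 : ℝ) + 1)) =
      - ((valency G : ℝ) * (a G 1 : ℝ) * (b G 1 : ℝ)) / ((a G 1 : ℝ) + 1) ^ 2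

/-- The `i`th distance matrix. -/
noncomputable def distMatrix (G : SimpleGraph X) (i : ℕ) : Matrix X X ℝ :=
  Matrix.of fun x y => if G.dist x y = i then 1 else 0

/-- The primitive idempotent associated with an eigenvalue `θ`: the matrix of the orthogonal
projection of the Euclidean space `ℝ^X` onto the `θ`-eigenspace of the adjacency matrix. -/
noncomputable def primitiveIdempotent (G : SimpleGraph X) [DecidableRel G.Adj] (θ : ℝ) :
    Matrix X X ℝ :=
  Matrix.toEuclideanLin.symm
    ((Module.End.eigenspace (Matrix.toEuclideanLin (G.adjMatrix ℝ)) θ).starProjection :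
      EuclideanSpace ℝ X →ₗ[ℝ] EuclideanSpace ℝ X)

/-- `σ 0, …, σ d` is the cosine sequence associated with the eigenvalue `θ`:
`E = |X|⁻¹ m ∑ σ_i A_i`, with `E` the primitive idempotent of `θ` and `m = rank E` the
multiplicity of `θ`. -/
def IsCosineSequence (G : SimpleGraph X) [DecidableRel G.Adj] (θ : ℝ) (σ : ℕ → ℝ) : Prop :=
  primitiveIdempotent G θ =
    ((Fintype.card X : ℝ)⁻¹ * ((primitiveIdempotent G θ).rank : ℝ)) •
      ∑ i ∈ Finset.range (G.diam + 1), σ i • distMatrix G i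

/-- The auxiliary parameter associated with `θ`, where `θ'` is the complement of `θ` in
`{θ₁, θ_d}`. -/
noncomputable def auxiliaryParameter (G : SimpleGraph X) (θ θ' : ℝ) : ℝ :=
  ((valency G : ℝ) ^ 2 - θ * θ') / ((valency G : ℝ) * (θ - θ'))

/-- The local graph of `x`: the subgraph induced on the neighbours of `x`. -/
abbrev localGraph (G : SimpleGraph X) (x : X) : SimpleGraph (G.neighborSet x) :=
  G.induce (G.neighborSet x)

/-- The multiplicity of `t` as an eigenvalue of the adjacency matrix of a graph. -/
noncomputable def eigMult (H : SimpleGraph X) [DecidableRel H.Adj] (t : ℝ) : ℕ :=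
  Module.finrank ℝ (Module.End.eigenspace (Matrix.toLin' (H.adjMatrix ℝ)) t)

end DistReg

/-! Let `B` be the adjacency matrix of the local graph. It has `k` vertices and constant row sum
`a₁`, so everything is decided by the eigenvalues `η` of `B` on the zero-sum vectors.

Each eigenvalue `θ` of the graph gives a positive semidefinite matrix whose entries depend only on
distance. Neighbours of `x` are pairwise at distance at most 2, so its restriction to them is a
combination of `1`, `B` and the all-ones matrix. On zero-sum vectors the last term vanishes, and the
three-term recurrence turns positivity into `(k - θ) ((k + θ - a₁) + (1 + θ) η) ≥ 0`
(`localGraph_dotProduct_nonneg`). Since `θ₁ > -1 > θ_d`, the eigenvalues `θ₁` and `θ_d` give a lower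
bound `p` and an upper bound `q` for all `η`.

The sum of `(η - p) (q - η)` is known from `tr B = 0` and `tr B² = k a₁`; tightness says exactly
that it is zero. All its terms are nonnegative, so every `η` is `p` or `q`
(`sub_mul_sub_mul_centering_eq_zero`, `IsTight.localGraph_mul_centering_eq_zero`).

Consequently `B²` is a combination of `B`, `1` and the all-ones matrix, which is strong regularity,
and the multiplicities are traces of spectral projections. The rest is algebra: tightness eliminates
`θ'`, and all parameters become rational functions of `k`, `a₁`, `b₁`, `θ` (`TightParameters`). -/

namespace DistReg

open Matrix

/-! ### Symmetric matrices with constant row sums, restricted to zero-sum vectors. -/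

section Centering

variable {V : Type*} [Fintype V] [DecidableEq V]

/-- The matrix of the orthogonal projection onto the vectors with zero sum. -/
noncomputable def centering (V : Type*) [Fintype V] [DecidableEq V] : Matrix V V ℝ :=
  1 - (Fintype.card V : ℝ)⁻¹ • Matrix.of fun _ _ => 1

theorem centering_isSymm : (centering V).IsSymm := by
  ext i j
  simp [centering, Matrix.one_apply, eq_comm]

theorem centering_mulVec_apply (v : V → ℝ) (i : V) :
    (centering V *ᵥ v) i = v i - (Fintype.card V : ℝ)⁻¹ * ∑ j, v j := by
  rw [centering, Matrix.sub_mulVec, Matrix.one_mulVec, Matrix.smul_mulVec]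
  simp [Matrix.mulVec, dotProduct]

theorem centering_mulVec_of_sum_eq_zero {v : V → ℝ} (hv : ∑ i, v i = 0) :
    centering V *ᵥ v = v := by
  ext i
  simp [centering_mulVec_apply, hv]

theorem sum_centering_mulVec (v : V → ℝ) : ∑ i, (centering V *ᵥ v) i = 0 := by
  rcases isEmpty_or_nonempty V with h | h
  · simp
  · have : (Fintype.card V : ℝ) ≠ 0 := by simp
    simp only [centering_mulVec_apply, Finset.sum_sub_distrib, Finset.sum_const, Finset.card_univ,
      nsmul_eq_mul]
    field_simp
    ring

theorem centering_mul_self : centering V * centering V = centering V := by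
  apply Matrix.toLin'.injective
  ext1 v
  ext1
  simp only [Matrix.toLin'_mul, LinearMap.comp_apply, Matrix.toLin'_apply]
  rw [centering_mulVec_of_sum_eq_zero (sum_centering_mulVec _)]

/-- By symmetry the column sums are also `a`, so multiplying the all-ones matrix by `B` on either
side scales it by `a`. -/
theorem centering_commute {B : Matrix V V ℝ} (hB : B.IsSymm) {a : ℝ}
    (ha : ∀ i, ∑ j, B i j = a) : Commute B (centering V) := by
  refine (Commute.one_right B).sub_right (Commute.smul_right ?_ _)
  ext i j
  have h : ∑ x, B x j = a := by
    rw [← ha j]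
    exact Finset.sum_congr rfl fun x _ => hB.apply j x
  simp [Matrix.mul_apply, ha, h]

/-- The constant vectors are eigenvectors for `m`; removing that direction removes `m` from the
trace. -/
theorem trace_mul_centering [Nonempty V] {M : Matrix V V ℝ} {m : ℝ} (hm : ∀ i, ∑ j, M i j = m) :
    (M * centering V).trace = M.trace - m := by
  have : (Fintype.card V : ℝ) ≠ 0 := by simp
  simp only [centering, Matrix.mul_sub, Matrix.trace_sub, Matrix.mul_one, Matrix.mul_smul,
    Matrix.trace_smul]
  congr 1
  simp [Matrix.trace, Matrix.mul_apply, hm]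

/-- A symmetric matrix with constant row sums that is nonnegative on the zero-sum vectors becomes
positive semidefinite when restricted to these vectors. -/
theorem posSemidef_mul_centering {M : Matrix V V ℝ} (hM : M.IsSymm) {a : ℝ}
    (ha : ∀ i, ∑ j, M i j = a)
    (h : ∀ v : V → ℝ, ∑ i, v i = 0 → 0 ≤ v ⬝ᵥ M *ᵥ v) : (M * centering V).PosSemidef := by
  have hc := centering_commute hM ha
  refine Matrix.PosSemidef.of_dotProduct_mulVec_nonneg ?_ fun v => ?_
  · rw [Matrix.IsHermitian, Matrix.conjTranspose_eq_transpose_of_trivial, Matrix.transpose_mul,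
      hM.eq, centering_isSymm.eq, hc.eq]
  · have h1 := h _ (sum_centering_mulVec v)
    have h2 : M * centering V = (centering V)ᵀ * M * centering V := by
      rw [centering_isSymm.eq, ← hc.eq, mul_assoc, centering_mul_self]
    rw [h2, star_trivial, ← Matrix.mulVec_mulVec, ← Matrix.mulVec_mulVec, Matrix.dotProduct_mulVec,
      Matrix.vecMul_transpose]
    exact h1

theorem sum_sub_smul_one {B : Matrix V V ℝ} {a : ℝ} (ha : ∀ i, ∑ j, B i j = a) (p : ℝ) (i : V) :
    ∑ j, (B - p • (1 : Matrix V V ℝ)) i j = a - p := by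
  simp [Matrix.one_apply, Finset.sum_sub_distrib, ha]

omit [Fintype V] in
theorem isSymm_sub_smul_one {B : Matrix V V ℝ} (hB : B.IsSymm) (p : ℝ) :
    (B - p • (1 : Matrix V V ℝ)).IsSymm :=
  hB.sub (Matrix.isSymm_one.smul p)

/-- If the eigenvalues on the zero-sum vectors lie in `[p, q]` and
`∑ (η - p) (q - η)` vanishes, then they all lie in `{p, q}`. -/
theorem sub_mul_sub_mul_centering_eq_zero [Nonempty V] {B : Matrix V V ℝ} (hB : B.IsSymm) {a : ℝ}
    (ha : ∀ i, ∑ j, B i j = a) {p q : ℝ} (hpq : p < q)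
    (hp : ∀ v : V → ℝ, ∑ i, v i = 0 → p * (v ⬝ᵥ v) ≤ v ⬝ᵥ B *ᵥ v)
    (hq : ∀ v : V → ℝ, ∑ i, v i = 0 → v ⬝ᵥ B *ᵥ v ≤ q * (v ⬝ᵥ v))
    (htr : (B * B).trace - (p + q) * B.trace + p * q * Fintype.card V = (a - p) * (a - q)) :
    (B - p • (1 : Matrix V V ℝ)) * (B - q • (1 : Matrix V V ℝ)) * centering V = 0 := by
  set C := centering V with hC
  have hBC : B * C = C * B := centering_commute hB ha
  have hCC : C * C = C := centering_mul_self
  set P := (B - p • (1 : Matrix V V ℝ)) * C with hP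
  set Q := (q • (1 : Matrix V V ℝ) - B) * C with hQ
  have hneg : q • (1 : Matrix V V ℝ) - B = -(B - q • (1 : Matrix V V ℝ)) := by abel
  have hPpos : P.PosSemidef := by
    refine posSemidef_mul_centering (isSymm_sub_smul_one hB p) (sum_sub_smul_one ha p) fun v hv => ?_
    have := hp v hv
    simp only [Matrix.sub_mulVec, Matrix.smul_mulVec, Matrix.one_mulVec, dotProduct_sub,
      dotProduct_smul, smul_eq_mul]
    linarith
  have hQpos : Q.PosSemidef := by
    refine posSemidef_mul_centering (a := -(a - q)) ?_ ?_ fun v hv => ?_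
    · rw [hneg]
      exact (isSymm_sub_smul_one hB q).neg
    · intro i
      rw [hneg, ← sum_sub_smul_one ha q i]
      simp only [Matrix.neg_apply, Finset.sum_neg_distrib]
    · have := hq v hv
      simp only [Matrix.sub_mulVec, Matrix.smul_mulVec, Matrix.one_mulVec, dotProduct_sub,
        dotProduct_smul, smul_eq_mul]
      linarith
  have hcomm1 : (q • (1 : Matrix V V ℝ) - B) * C = C * (q • (1 : Matrix V V ℝ) - B) := by
    simp [Matrix.sub_mul, Matrix.mul_sub, hBC]
  have hcomm2 : (B - p • (1 : Matrix V V ℝ)) * C = C * (B - p • (1 : Matrix V V ℝ)) := by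
    simp [Matrix.sub_mul, Matrix.mul_sub, hBC]
  have hPQ' : P * Q = (B - p • (1 : Matrix V V ℝ)) * (q • (1 : Matrix V V ℝ) - B) * C := by
    rw [hP, hQ, mul_assoc, ← mul_assoc C, ← hcomm1, mul_assoc _ C C, hCC, mul_assoc]
  have hQP : Q * P = P * Q := by
    rw [hPQ', hP, hQ, mul_assoc, ← mul_assoc C, ← hcomm2, mul_assoc _ C C, hCC, ← mul_assoc]
    congr 1
    simp only [Matrix.sub_mul, Matrix.mul_sub, Matrix.smul_mul, Matrix.mul_smul, Matrix.one_mul,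
      Matrix.mul_one, smul_sub, smul_smul, mul_comm q p]
    abel
  have hsum : P + Q = (q - p) • C := by
    rw [hP, hQ, ← Matrix.add_mul, sub_add_sub_cancel', ← sub_smul, Matrix.smul_mul, Matrix.one_mul]
  -- `P + Q` is `q - p` times the projection `C`, which fixes `P * Q`. Both summands on the right
  -- are congruences of positive semidefinite matrices, so `P * Q` is positive semidefinite without
  -- simultaneous diagonalization.
  have hkey : (q - p) • (P * Q) = P * Q * P + Q * P * Q := by
    have h1 : P * Q * P + Q * P * Q = P * Q * (P + Q) := by rw [hQP, mul_add]
    rw [h1, hsum, Matrix.mul_smul, hPQ', mul_assoc _ C C, hCC]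
  have hpos : (P * Q).PosSemidef := by
    have h1 : (P * Q * P + Q * P * Q).PosSemidef := by
      have e1 := hQpos.conjTranspose_mul_mul_same P
      have e2 := hPpos.conjTranspose_mul_mul_same Q
      rw [hPpos.1.eq] at e1
      rw [hQpos.1.eq] at e2
      exact e1.add e2
    have h2 : P * Q = (q - p)⁻¹ • (P * Q * P + Q * P * Q) := by
      rw [← hkey, smul_smul, inv_mul_cancel₀ (by linarith), one_smul]
    rw [h2]
    exact h1.smul (by rw [inv_nonneg]; linarith)
  -- The trace of `P * Q` is the sum of `(η - p) (q - η)` over the zero-sum space; its vanishing is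
  -- a rewriting of `htr`.
  have htr0 : (P * Q).trace = 0 := by
    have hrow : ∀ i, ∑ j, ((B - p • (1 : Matrix V V ℝ)) * (q • (1 : Matrix V V ℝ) - B)) i j
        = (a - p) * (q - a) := by
      intro i
      simp only [Matrix.mul_apply]
      rw [Finset.sum_comm]
      simp only [← Finset.mul_sum]
      have : ∀ x, ∑ j, (q • (1 : Matrix V V ℝ) - B) x j = q - a := by
        intro x
        simp [Matrix.one_apply, Finset.sum_sub_distrib, ha]
      simp only [this, ← Finset.sum_mul, sum_sub_smul_one ha p]
    rw [hPQ', trace_mul_centering hrow]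
    simp only [Matrix.sub_mul, Matrix.mul_sub, Matrix.trace_sub, Matrix.smul_mul, Matrix.mul_smul,
      Matrix.one_mul, Matrix.mul_one, Matrix.trace_smul, Matrix.trace_one, smul_eq_mul]
    linarith
  have h0 := hpos.trace_eq_zero_iff.1 htr0
  have : (B - p • (1 : Matrix V V ℝ)) * (B - q • (1 : Matrix V V ℝ)) * C = -(P * Q) := by
    rw [hPQ', hneg]
    simp only [Matrix.mul_neg, Matrix.neg_mul, neg_neg]
  rw [this, h0, neg_zero]

omit [DecidableEq V] in
theorem sum_eq_zero_of_mulVec_eq_smul {B : Matrix V V ℝ} (hB : B.IsSymm) {a : ℝ}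
    (ha : ∀ i, ∑ j, B i j = a) {t : ℝ} (hta : t ≠ a) {v : V → ℝ} (hv : B *ᵥ v = t • v) :
    ∑ i, v i = 0 := by
  have h1 : ∑ i, (B *ᵥ v) i = a * ∑ i, v i := by
    simp only [Matrix.mulVec, dotProduct]
    rw [Finset.sum_comm]
    simp only [← Finset.sum_mul]
    rw [Finset.mul_sum]
    refine Finset.sum_congr rfl fun i _ => ?_
    rw [← ha i]
    congr 1
    exact Finset.sum_congr rfl fun x _ => hB.apply i x
  have h2 : (t - a) * ∑ i, v i = 0 := by
    rw [sub_mul, ← h1, hv]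
    simp [Finset.mul_sum]
  exact (mul_eq_zero.1 h2).resolve_left (sub_ne_zero.2 hta)

/-- The dimension is the trace of a projection onto the eigenspace. As `r` and `s` are the only
possible eigenvalues on zero-sum vectors, `(B - s) / (r - s)` after centering is such a projection.
-/
theorem finrank_eigenspace_eq [Nonempty V] {B : Matrix V V ℝ} (hB : B.IsSymm) {a : ℝ}
    (ha : ∀ i, ∑ j, B i j = a) (h0 : B.trace = 0) {r s : ℝ} (hrs : r ≠ s) (hra : r ≠ a)
    (h : (B - r • (1 : Matrix V V ℝ)) * (B - s • (1 : Matrix V V ℝ)) * centering V = 0) :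
    (Module.finrank ℝ (Module.End.eigenspace (Matrix.toLin' B) r) : ℝ) =
      - (s * (Fintype.card V - 1) + a) / (r - s) := by
  have hrs' : r - s ≠ 0 := sub_ne_zero.2 hrs
  set M : Matrix V V ℝ := (r - s)⁻¹ • ((B - s • (1 : Matrix V V ℝ)) * centering V) with hM
  have hproj : LinearMap.IsProj (Module.End.eigenspace (Matrix.toLin' B) r) (Matrix.toLin' M) := by
    constructor
    · intro v
      rw [Module.End.mem_eigenspace_iff, ← sub_eq_zero]
      have : (B - r • (1 : Matrix V V ℝ)) * M = 0 := by
        rw [hM, Matrix.mul_smul, ← mul_assoc, h, smul_zero]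
      have h2 := congrArg (fun N => N *ᵥ v) this
      simpa [← Matrix.mulVec_mulVec, Matrix.sub_mulVec, Matrix.smul_mulVec] using h2
    · intro v hv
      rw [Module.End.mem_eigenspace_iff, Matrix.toLin'_apply] at hv
      rw [Matrix.toLin'_apply, hM, Matrix.smul_mulVec, ← Matrix.mulVec_mulVec,
        centering_mulVec_of_sum_eq_zero (sum_eq_zero_of_mulVec_eq_smul hB ha hra hv),
        Matrix.sub_mulVec, hv, Matrix.smul_mulVec, Matrix.one_mulVec, ← sub_smul, smul_smul,
        inv_mul_cancel₀ hrs', one_smul]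
  rw [← hproj.trace, Matrix.trace_toLin'_eq, hM, Matrix.trace_smul,
    trace_mul_centering (sum_sub_smul_one ha s), Matrix.trace_sub, h0, Matrix.trace_smul,
    Matrix.trace_one]
  simp only [smul_eq_mul]
  field_simp
  ring

theorem eigenvalue_mem_of_mul_centering_eq_zero {B : Matrix V V ℝ} (hB : B.IsSymm) {a : ℝ}
    (ha : ∀ i, ∑ j, B i j = a) {r s : ℝ}
    (h : (B - r • (1 : Matrix V V ℝ)) * (B - s • (1 : Matrix V V ℝ)) * centering V = 0)
    {t : ℝ} {v : V → ℝ} (hv0 : v ≠ 0) (hv : B *ᵥ v = t • v) : t = a ∨ t = r ∨ t = s := by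
  by_contra! hne
  obtain ⟨hta, htr, hts⟩ := hne
  have h2 := congrArg (fun N => N *ᵥ v) h
  have h3 : ∀ u : ℝ, (B - u • (1 : Matrix V V ℝ)) *ᵥ v = (t - u) • v := by
    intro u
    rw [Matrix.sub_mulVec, hv, Matrix.smul_mulVec, Matrix.one_mulVec, ← sub_smul]
  simp only [← Matrix.mulVec_mulVec,
    centering_mulVec_of_sum_eq_zero (sum_eq_zero_of_mulVec_eq_smul hB ha hta hv), h3,
    Matrix.mulVec_smul, Matrix.zero_mulVec, smul_smul] at h2
  rcases smul_eq_zero.1 h2 with h4 | h4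
  · rcases mul_eq_zero.1 h4 with h5 | h5
    · exact hts (sub_eq_zero.1 h5)
    · exact htr (sub_eq_zero.1 h5)
  · exact hv0 h4

/-- The square of a symmetric matrix with constant row sums and two further eigenvalues. -/
theorem mul_self_apply_of_mul_centering_eq_zero [Nonempty V] {B : Matrix V V ℝ} {a : ℝ}
    (ha : ∀ i, ∑ j, B i j = a) {r s : ℝ}
    (h : (B - r • (1 : Matrix V V ℝ)) * (B - s • (1 : Matrix V V ℝ)) * centering V = 0) (i j : V) :
    (B * B) i j = (r + s) * B i j - r * s * (1 : Matrix V V ℝ) i j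
      + (a - r) * (a - s) / Fintype.card V := by
  -- With this, `h` says that `(B - r) (B - s)` is a multiple of the all-ones matrix; expanding
  -- gives `B * B`.
  have hrow : ((B - r • (1 : Matrix V V ℝ)) * (B - s • (1 : Matrix V V ℝ))) *
      (Matrix.of fun _ _ => (1 : ℝ)) = ((a - r) * (a - s)) • Matrix.of fun _ _ => (1 : ℝ) := by
    ext x y
    rw [mul_assoc, Matrix.mul_apply]
    have e : ∀ z, ((B - s • (1 : Matrix V V ℝ)) *
        (Matrix.of fun _ _ => (1 : ℝ) : Matrix V V ℝ)) z y = a - s := by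
      intro z
      rw [Matrix.mul_apply, ← sum_sub_smul_one ha s z]
      simp
    simp only [e, ← Finset.sum_mul, sum_sub_smul_one ha r]
    simp
  rw [centering, Matrix.mul_sub, Matrix.mul_one, Matrix.mul_smul, hrow, sub_eq_zero] at h
  have h2 := congrFun (congrFun h i) j
  simp only [Matrix.sub_mul, Matrix.mul_sub, Matrix.smul_mul, Matrix.mul_smul, Matrix.one_mul,
    Matrix.mul_one, Matrix.sub_apply, Matrix.smul_apply, Matrix.of_apply, smul_eq_mul] at h2
  field_simp
  field_simp at h2
  linarith

end Centering

theorem mem_spectrum_iff_exists_mulVec {V : Type*} [Fintype V] [DecidableEq V] {B : Matrix V V ℝ}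
    {t : ℝ} : t ∈ spectrum ℝ B ↔ ∃ w : V → ℝ, w ≠ 0 ∧ B *ᵥ w = t • w := by
  rw [← Matrix.spectrum_toLin', ← Module.End.hasEigenvalue_iff_mem_spectrum]
  constructor
  · intro h
    obtain ⟨w, hw⟩ := h.exists_hasEigenvector
    exact ⟨w, hw.2, by simpa using hw.apply_eq_smul⟩
  · rintro ⟨w, hw0, hw⟩
    exact Module.End.hasEigenvalue_of_hasEigenvector
      ⟨by rw [Module.End.mem_eigenspace_iff]; simpa using hw, hw0⟩

/-! ### The Bose–Mesner algebra and its positive semidefinite elements. -/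

section Bose

variable {X : Type*} [Fintype X] {G : SimpleGraph X}

/-- The matrices whose entries depend only on the distance. -/
def IsDistanceMatrix (G : SimpleGraph X) (M : Matrix X X ℝ) : Prop :=
  ∃ g : ℕ → ℝ, ∀ x y, M x y = g (G.dist x y)

omit [Fintype X] in
theorem isDistanceMatrix_of_eq {M : Matrix X X ℝ}
    (h : ∀ x y x' y', G.dist x y = G.dist x' y' → M x y = M x' y') : IsDistanceMatrix G M := by
  have h1 : Function.FactorsThrough (fun p : X × X => M p.1 p.2)
      (fun p : X × X => G.dist p.1 p.2) := fun p q hpq => h _ _ _ _ hpq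
  obtain ⟨e, he⟩ := (Function.factorsThrough_iff _).1 h1
  exact ⟨e, fun x y => congrFun he (x, y)⟩

omit [Fintype X] in
theorem IsDistanceMatrix.isSymm {M : Matrix X X ℝ} (h : IsDistanceMatrix G M) : M.IsSymm := by
  obtain ⟨g, hg⟩ := h
  ext x y
  rw [Matrix.transpose_apply, hg, hg, G.dist_comm]

theorem IsDistanceRegular.ediam_ne_top (hG : IsDistanceRegular G) : G.ediam ≠ ⊤ := by
  have := hG.connected.nonempty
  exact G.connected_iff_ediam_ne_top.1 hG.connected

theorem IsDistanceRegular.dist_le (hG : IsDistanceRegular G) (x y : X) :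
    G.dist x y ≤ G.diam :=
  SimpleGraph.dist_le_diam hG.ediam_ne_top

/-- Grouping the middle vertex by its distances to `x` and `y` writes the entry with the counts
`cellCard`, which depend only on the distance of `x` and `y`. -/
theorem IsDistanceMatrix.mul (hG : IsDistanceRegular G) {M N : Matrix X X ℝ}
    (hM : IsDistanceMatrix G M) (hN : IsDistanceMatrix G N) : IsDistanceMatrix G (M * N) := by
  obtain ⟨g, hg⟩ := hM
  obtain ⟨f, hf⟩ := hN
  have key : ∀ x y, (M * N) x y = ∑ p ∈ Finset.range (G.diam + 1) ×ˢ Finset.range (G.diam + 1),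
      (cellCard G p.1 p.2 x y : ℝ) * (g p.1 * f p.2) := by
    intro x y
    rw [Matrix.mul_apply, ← Finset.sum_fiberwise_of_maps_to
      (t := Finset.range (G.diam + 1) ×ˢ Finset.range (G.diam + 1))
      (g := fun z => (G.dist x z, G.dist y z))]
    · refine Finset.sum_congr rfl fun p _ => ?_
      rw [cellCard, ← nsmul_eq_mul, ← Finset.sum_const]
      simp only [Prod.ext_iff]
      refine Finset.sum_congr rfl fun z hz => ?_
      simp only [Finset.mem_filter, Finset.mem_univ, true_and] at hz
      rw [hg, hf, G.dist_comm (u := z), hz.1, hz.2]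
    · intro z _
      simp [hG.dist_le]
  refine isDistanceMatrix_of_eq fun x y x' y' h => ?_
  rw [key, key]
  refine Finset.sum_congr rfl fun p hp => ?_
  simp only [Finset.mem_product, Finset.mem_range, Nat.lt_succ_iff] at hp
  rw [hG.cellCard_eq (G.dist x y) p.1 p.2 (hG.dist_le _ _) hp.1 hp.2 x y x' y' rfl h.symm]

variable [DecidableEq X]

/-- The algebra of the matrices whose entries depend only on the distance. -/
def boseMesner (hG : IsDistanceRegular G) : Subalgebra ℝ (Matrix X X ℝ) where
  carrier := {M | IsDistanceMatrix G M}
  mul_mem' hM hN := hM.mul hG hN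
  add_mem' := by
    rintro M N ⟨g, hg⟩ ⟨f, hf⟩
    exact ⟨g + f, fun x y => by simp [hg, hf]⟩
  algebraMap_mem' r := by
    refine ⟨fun n => if n = 0 then r else 0, fun x y => ?_⟩
    simp [Matrix.algebraMap_matrix_apply, hG.connected.dist_eq_zero_iff]

variable [DecidableRel G.Adj]

theorem adjMatrix_mem_boseMesner (hG : IsDistanceRegular G) :
    G.adjMatrix ℝ ∈ boseMesner hG :=
  ⟨fun n => if n = 1 then 1 else 0, fun x y => by
    simp [SimpleGraph.adjMatrix_apply, SimpleGraph.dist_eq_one_iff_adj]⟩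

/-- A nonzero matrix of the Bose–Mesner algebra whose columns are `θ`-eigenvectors. -/
theorem exists_mem_boseMesner_mul_eq_smul (hG : IsDistanceRegular G) {θ : ℝ}
    (hθ : θ ∈ spectrum ℝ (G.adjMatrix ℝ)) :
    ∃ Q ∈ boseMesner hG, Q ≠ 0 ∧ G.adjMatrix ℝ * Q = θ • Q := by
  set A := G.adjMatrix ℝ with hA
  have hint : IsIntegral ℝ A := IsIntegral.of_finite ℝ A
  have hroot : (minpoly ℝ A).IsRoot θ := by
    rw [← Matrix.spectrum_toLin', ← Module.End.hasEigenvalue_iff_mem_spectrum] at hθ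
    rw [← Matrix.minpoly_toLin']
    exact Module.End.isRoot_of_hasEigenvalue hθ
  obtain ⟨q, hq⟩ := Polynomial.dvd_iff_isRoot.2 hroot
  have hm0 := minpoly.ne_zero hint
  have hq0 : q ≠ 0 := by
    rintro rfl
    exact hm0 (by rw [hq, mul_zero])
  -- Here `q` is the minimal polynomial of `A` divided by `X - θ`: its value is nonzero because the
  -- degree is too small, and `A - θ` annihilates it.
  refine ⟨Polynomial.aeval A q, ?_, ?_, ?_⟩
  · exact Algebra.adjoin_le (Set.singleton_subset_iff.2 (adjMatrix_mem_boseMesner hG))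
      (Polynomial.aeval_mem_adjoin_singleton ℝ A)
  · intro h0
    have h1 := minpoly.degree_le_of_ne_zero ℝ A hq0 h0
    rw [hq, Polynomial.degree_mul, Polynomial.degree_X_sub_C,
      Polynomial.degree_eq_natDegree hq0] at h1
    have h2 : (1 : ℕ) + q.natDegree ≤ q.natDegree := by exact_mod_cast h1
    omega
  · have h1 := minpoly.aeval ℝ A
    rw [hq, map_mul, map_sub, Polynomial.aeval_X, Polynomial.aeval_C, sub_mul, sub_eq_zero] at h1
    rw [h1, Algebra.algebraMap_eq_smul_one, smul_mul_assoc, one_mul]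

/-- A positive semidefinite matrix of the Bose–Mesner algebra whose columns are
`θ`-eigenvectors. -/
theorem exists_posSemidef_of_mem_spectrum (hG : IsDistanceRegular G) {θ : ℝ}
    (hθ : θ ∈ spectrum ℝ (G.adjMatrix ℝ)) :
    ∃ g : ℕ → ℝ, 0 < g 0 ∧
      G.adjMatrix ℝ * (Matrix.of fun x y => g (G.dist x y)) =
        θ • (Matrix.of fun x y => g (G.dist x y)) ∧
      (Matrix.of fun x y => g (G.dist x y)).PosSemidef := by
  obtain ⟨Q, hQ, hQ0, hAQ⟩ := exists_mem_boseMesner_mul_eq_smul hG hθ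
  -- Squaring the symmetric matrix `Q` gives positivity and stays inside the algebra.
  obtain ⟨g, hg⟩ := (boseMesner hG).mul_mem hQ hQ
  have hsymm : Q.IsSymm := IsDistanceMatrix.isSymm hQ
  have hF : (Matrix.of fun x y => g (G.dist x y)) = Q * Q := by
    ext x y
    rw [hg, Matrix.of_apply]
  refine ⟨g, ?_, ?_, ?_⟩
  · obtain ⟨x, y, hxy⟩ : ∃ x y, Q x y ≠ 0 := by
      by_contra! h
      exact hQ0 (by ext x y; exact h x y)
    rw [← G.dist_self (v := x), ← hg, Matrix.mul_apply]
    refine Finset.sum_pos' (fun z _ => ?_) ⟨y, Finset.mem_univ _, ?_⟩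
    · rw [hsymm.apply]
      exact mul_self_nonneg _
    · rw [hsymm.apply]
      exact mul_self_pos.2 (by rwa [hsymm.apply x y])
  · rw [hF, ← mul_assoc, hAQ, smul_mul_assoc]
  · rw [hF]
    have := Matrix.posSemidef_self_mul_conjTranspose Q
    rwa [Matrix.conjTranspose_eq_transpose_of_trivial, hsymm.eq] at this

end Bose

/-! ### Counts among neighbours and the first cosine recurrences. -/

section Counting

variable {X : Type*} [Fintype X] {G : SimpleGraph X} [DecidableRel G.Adj]

theorem degree_eq_valency (hG : IsDistanceRegular G) (hd : 1 ≤ G.diam) (x : X) :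
    G.degree x = valency G := by
  rw [valency, b, ← hG.cellCard_eq_intersectionNumber (by omega) hd hd (G.dist_self (v := x)),
    cellCard, ← SimpleGraph.card_neighborFinset_eq_degree]
  congr 1
  ext z
  simp [SimpleGraph.dist_eq_one_iff_adj]

theorem card_neighborFinset_filter (hG : IsDistanceRegular G) (hd : 2 ≤ G.diam) {x y : X}
    (hxy : G.Adj x y) {j : ℕ} (hj : j ≤ 2) :
    ((G.neighborFinset x).filter fun z => G.dist y z = j).card = intersectionNumber G 1 1 j := by
  rw [← hG.cellCard_eq_intersectionNumber (by omega) (by omega) (by omega)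
    (SimpleGraph.dist_eq_one_iff_adj.2 hxy), cellCard]
  congr 1
  ext z
  simp [SimpleGraph.dist_eq_one_iff_adj]

theorem intersectionNumber_one_one_zero (hG : IsDistanceRegular G) (hd : 2 ≤ G.diam) {x y : X}
    (hxy : G.Adj x y) : intersectionNumber G 1 1 0 = 1 := by
  rw [← card_neighborFinset_filter hG hd hxy (by omega), Finset.card_eq_one]
  refine ⟨y, ?_⟩
  ext z
  simp only [hG.connected.dist_eq_zero_iff, Finset.mem_filter, SimpleGraph.mem_neighborFinset,
    Finset.mem_singleton]
  constructor
  · rintro ⟨_, rfl⟩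
    rfl
  · rintro rfl
    exact ⟨hxy, rfl⟩

omit [DecidableRel G.Adj] in
theorem dist_le_two_of_adj (hG : IsDistanceRegular G) {x y z : X} (hxy : G.Adj x y)
    (hxz : G.Adj x z) : G.dist y z ≤ 2 := by
  have := hG.connected.dist_triangle (u := y) (v := x) (w := z)
  rwa [SimpleGraph.dist_eq_one_iff_adj.2 hxy.symm, SimpleGraph.dist_eq_one_iff_adj.2 hxz] at this

theorem sum_neighborFinset_dist (hG : IsDistanceRegular G) (hd : 2 ≤ G.diam) {x y : X}
    (hxy : G.Adj x y) (g : ℕ → ℝ) :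
    ∑ z ∈ G.neighborFinset x, g (G.dist y z) = g 0 + a G 1 * g 1 + b G 1 * g 2 := by
  rw [← Finset.sum_fiberwise_of_maps_to (t := Finset.range 3) (g := fun z => G.dist y z)]
  · have : ∀ j ∈ Finset.range 3, (∑ z ∈ G.neighborFinset x with G.dist y z = j, g (G.dist y z))
        = intersectionNumber G 1 1 j * g j := by
      intro j hj
      rw [← card_neighborFinset_filter hG hd hxy (by simpa [Nat.lt_succ_iff] using hj),
        ← nsmul_eq_mul, ← Finset.sum_const]
      exact Finset.sum_congr rfl fun z hz => by rw [(Finset.mem_filter.1 hz).2]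
    rw [Finset.sum_congr rfl this]
    simp [Finset.sum_range_succ, intersectionNumber_one_one_zero hG hd hxy, a, b]
  · intro z hz
    rw [SimpleGraph.mem_neighborFinset] at hz
    exact Finset.mem_range.2 (Nat.lt_succ_of_le (dist_le_two_of_adj hG hxy hz))

theorem valency_eq (hG : IsDistanceRegular G) (hd : 2 ≤ G.diam) {x y : X} (hxy : G.Adj x y) :
    (valency G : ℝ) = 1 + a G 1 + b G 1 := by
  have := sum_neighborFinset_dist hG hd hxy (fun _ => 1)
  simpa [degree_eq_valency hG (by omega)] using this

/-- The three-term recurrence at distances `0` and `1`. -/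
theorem cosine_recurrence (hG : IsDistanceRegular G) (hd : 2 ≤ G.diam) {x y : X}
    (hxy : G.Adj x y) {g : ℕ → ℝ} {θ : ℝ}
    (h : G.adjMatrix ℝ * (Matrix.of fun x y => g (G.dist x y)) =
        θ • (Matrix.of fun x y => g (G.dist x y))) :
    valency G * g 1 = θ * g 0 ∧ g 0 + a G 1 * g 1 + b G 1 * g 2 = θ * g 1 := by
  have key : ∀ u v, ∑ z ∈ G.neighborFinset u, g (G.dist v z) = θ * g (G.dist u v) := by
    intro u v
    have := congrFun (congrFun h u) v
    simpa [SimpleGraph.adjMatrix_mul_apply, G.dist_comm (v := v)] using this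
  constructor
  · have h1 := key x x
    rw [SimpleGraph.dist_self, ← degree_eq_valency hG (by omega) x] at *
    rw [← h1, ← SimpleGraph.card_neighborFinset_eq_degree, ← nsmul_eq_mul, ← Finset.sum_const]
    refine Finset.sum_congr rfl fun z hz => ?_
    rw [SimpleGraph.mem_neighborFinset] at hz
    rw [SimpleGraph.dist_eq_one_iff_adj.2 hz]
  · rw [← sum_neighborFinset_dist hG hd hxy, key, SimpleGraph.dist_eq_one_iff_adj.2 hxy]

end Counting

/-! ### Bounds on the spectrum of the whole graph. -/

section Extreme

variable {X : Type*} [Fintype X] {G : SimpleGraph X} [DecidableRel G.Adj]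

/-- An eigenvector for an eigenvalue `≥ k` (or `≤ -k`) is constant (or changes sign) along
edges. -/
theorem eq_mul_of_adj_of_le {k : ℝ} (hk : ∀ x, (G.degree x : ℝ) = k) {θ s : ℝ} (hs : s * s = 1)
    (hθ : k ≤ s * θ) {w : X → ℝ} (hw : G.adjMatrix ℝ *ᵥ w = θ • w) {x y : X} (hxy : G.Adj x y) :
    w x = s * w y := by
  have h1 : ∀ x, ∑ y, G.adjMatrix ℝ x y = k := fun x => by
    rw [← hk x]
    simp [SimpleGraph.adjMatrix_apply, SimpleGraph.card_neighborFinset_eq_degree,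
      ← SimpleGraph.neighborFinset_eq_filter]
  have h2 : ∀ x, ∑ y, G.adjMatrix ℝ x y * w y = θ * w x := fun x => by
    have := congrFun hw x
    simpa [Matrix.mulVec, dotProduct] using this
  have hsymm : ∀ x y, G.adjMatrix ℝ x y = G.adjMatrix ℝ y x := fun x y =>
    G.isSymm_adjMatrix.apply y x
  -- Here `s` is a sign. The sum of squares over edges equals a nonpositive multiple of `∑ w x ^ 2`,
  -- so every term is zero.
  have key : ∑ x, ∑ y, G.adjMatrix ℝ x y * (w x - s * w y) ^ 2 =
      2 * (k - s * θ) * ∑ x, w x ^ 2 := by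
    have e1 : ∑ x, ∑ y, G.adjMatrix ℝ x y * w x ^ 2 = k * ∑ x, w x ^ 2 := by
      simp only [← Finset.sum_mul, h1, Finset.mul_sum]
    have e2 : ∑ x, ∑ y, G.adjMatrix ℝ x y * w y ^ 2 = k * ∑ x, w x ^ 2 := by
      have h1' : ∀ y, ∑ x, G.adjMatrix ℝ x y = k := fun y => by
        rw [← h1 y]
        exact Finset.sum_congr rfl fun x _ => hsymm x y
      rw [Finset.sum_comm]
      simp only [← Finset.sum_mul, h1', Finset.mul_sum]
    have e3 : ∑ x, ∑ y, w x * (G.adjMatrix ℝ x y * w y) = θ * ∑ x, w x ^ 2 := by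
      simp only [← Finset.mul_sum, h2]
      rw [Finset.mul_sum]
      exact Finset.sum_congr rfl fun x _ => by ring
    have : ∀ x y, G.adjMatrix ℝ x y * (w x - s * w y) ^ 2 =
        G.adjMatrix ℝ x y * w x ^ 2 + G.adjMatrix ℝ x y * w y ^ 2
          - 2 * s * (w x * (G.adjMatrix ℝ x y * w y)) := by
      intro x y
      linear_combination G.adjMatrix ℝ x y * w y ^ 2 * hs
    simp only [this, Finset.sum_add_distrib, Finset.sum_sub_distrib, ← Finset.mul_sum]
    simp only [Finset.mul_sum] at e1 e2 e3 ⊢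
    rw [e1, e2]
    simp only [← Finset.mul_sum] at e1 e2 e3 ⊢
    rw [e3]
    ring
  have hnn : ∀ x y, 0 ≤ G.adjMatrix ℝ x y * (w x - s * w y) ^ 2 := fun x y => by
    rw [SimpleGraph.adjMatrix_apply]
    split_ifs <;> positivity
  have hle : ∑ x, ∑ y, G.adjMatrix ℝ x y * (w x - s * w y) ^ 2 ≤ 0 := by
    rw [key]
    have : 0 ≤ ∑ x, w x ^ 2 := Finset.sum_nonneg fun x _ => sq_nonneg _
    nlinarith
  have h0 := le_antisymm hle (Finset.sum_nonneg fun x _ => Finset.sum_nonneg fun y _ => hnn x y)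
  have h3 := (Finset.sum_eq_zero_iff_of_nonneg
    (fun x _ => Finset.sum_nonneg fun y _ => hnn x y)).1 h0 x (Finset.mem_univ _)
  have h4 := (Finset.sum_eq_zero_iff_of_nonneg (fun y _ => hnn x y)).1 h3 y (Finset.mem_univ _)
  rw [SimpleGraph.adjMatrix_apply, if_pos hxy, one_mul] at h4
  exact sub_eq_zero.1 (pow_eq_zero_iff (two_ne_zero) |>.1 h4)

omit [Fintype X] [DecidableRel G.Adj] in
theorem eq_pow_length_mul {s : ℝ} {w : X → ℝ} (h : ∀ x y, G.Adj x y → w x = s * w y) {x y : X}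
    (p : G.Walk x y) : w x = s ^ p.length * w y := by
  induction p with
  | nil => simp
  | cons hadj p ih => rw [SimpleGraph.Walk.length_cons, pow_succ', mul_assoc, ← ih, h _ _ hadj]

omit [Fintype X] [DecidableRel G.Adj] in
theorem eq_pow_dist_mul (hG : G.Connected) {s : ℝ} {w : X → ℝ}
    (h : ∀ x y, G.Adj x y → w x = s * w y) (x y : X) : w x = s ^ G.dist x y * w y := by
  obtain ⟨p, hp⟩ := hG.exists_walk_length_eq_dist x y
  rw [← hp]
  exact eq_pow_length_mul h p

variable [DecidableEq X]

theorem bipartite_of_le_neg_valency (hG : IsDistanceRegular G) (hd : 1 ≤ G.diam) {θ : ℝ}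
    (hθ : θ ∈ spectrum ℝ (G.adjMatrix ℝ)) (hle : θ ≤ -(valency G : ℝ)) : Bipartite G := by
  obtain ⟨w, hw0, hw⟩ := mem_spectrum_iff_exists_mulVec.1 hθ
  have hadj : ∀ x y, G.Adj x y → w x = (-1) * w y := fun x y hxy =>
    eq_mul_of_adj_of_le (k := valency G) (fun x => by rw [degree_eq_valency hG hd]) (by norm_num)
      (by linarith) hw hxy
  intro i hi
  by_contra hne
  rw [a, intersectionNumber] at hne
  split_ifs at hne with H
  · have hpos := Nat.pos_of_ne_zero hne
    rw [cellCard, Finset.card_pos] at hpos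
    obtain ⟨z, hz⟩ := hpos
    simp only [Finset.mem_filter, Finset.mem_univ, true_and] at hz
    have hxy := H.choose_spec
    set x := H.choose.1
    set y := H.choose.2
    have hxz := hadj x z (SimpleGraph.dist_eq_one_iff_adj.1 hz.1)
    have h1 := eq_pow_dist_mul hG.connected hadj x y
    have h2 := eq_pow_dist_mul hG.connected hadj z y
    rw [hxy] at h1
    rw [G.dist_comm, hz.2] at h2
    -- `x` and `z` are both at distance `i` from `y`, so `w x = w z`; they are adjacent, so `w x =
    -- -w z`.
    have hx0 : w x = 0 := by
      rw [← h1] at h2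
      linarith
    apply hw0
    ext u
    rw [eq_pow_dist_mul hG.connected hadj u x, hx0, mul_zero, Pi.zero_apply]
  · exact hne rfl

omit [DecidableEq X] in
theorem sum_adjMatrix (hG : IsDistanceRegular G) (hd : 1 ≤ G.diam) (x : X) :
    ∑ y, G.adjMatrix ℝ x y = valency G := by
  rw [← degree_eq_valency hG hd x]
  simp [SimpleGraph.adjMatrix_apply, ← SimpleGraph.neighborFinset_eq_filter]

theorem le_valency_of_mem_spectrum (hG : IsDistanceRegular G) (hd : 1 ≤ G.diam) {θ : ℝ}
    (hθ : θ ∈ spectrum ℝ (G.adjMatrix ℝ)) : θ ≤ valency G := by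
  by_contra! hlt
  obtain ⟨w, hw0, hw⟩ := mem_spectrum_iff_exists_mulVec.1 hθ
  have hadj : ∀ x y, G.Adj x y → w x = 1 * w y := fun x y hxy =>
    eq_mul_of_adj_of_le (k := valency G) (fun x => by rw [degree_eq_valency hG hd]) (by norm_num)
      (by linarith) hw hxy
  have hconst : ∀ x y, w x = w y := fun x y => by
    simpa using eq_pow_dist_mul hG.connected hadj x y
  apply hw0
  ext x
  have h1 := congrFun hw x
  have h2 : (G.adjMatrix ℝ *ᵥ w) x = valency G * w x := by
    rw [← sum_adjMatrix hG hd x, Finset.sum_mul]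
    exact Finset.sum_congr rfl fun y _ => by rw [hconst y x]
  rw [h2, Pi.smul_apply, smul_eq_mul] at h1
  have h3 : (θ - valency G) * w x = 0 := by linarith
  exact (mul_eq_zero.1 h3).resolve_left (by linarith)

theorem valency_mem_spectrum (hG : IsDistanceRegular G) (hd : 1 ≤ G.diam) :
    (valency G : ℝ) ∈ spectrum ℝ (G.adjMatrix ℝ) := by
  rw [mem_spectrum_iff_exists_mulVec]
  have := hG.connected.nonempty
  refine ⟨fun _ => 1, ?_, ?_⟩
  · intro h
    simpa using congrFun h (Classical.arbitrary X)
  · ext x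
    simpa [Matrix.mulVec, dotProduct] using sum_adjMatrix hG hd x

/-- On the zero-sum vectors the Rayleigh quotient is at most the second largest eigenvalue. -/
theorem dotProduct_adjMatrix_mulVec_le (hG : IsDistanceRegular G) (hd : 1 ≤ G.diam) {t : ℝ}
    (ht : ∀ θ ∈ spectrum ℝ (G.adjMatrix ℝ), θ ≤ t ∨ θ = valency G) {v : X → ℝ}
    (hv : ∑ x, v x = 0) : v ⬝ᵥ G.adjMatrix ℝ *ᵥ v ≤ t * (v ⬝ᵥ v) := by
  set A := G.adjMatrix ℝ with hA
  have hsymm : A.IsSymm := G.isSymm_adjMatrix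
  have hrow := sum_adjMatrix hG hd
  have hcomm := centering_commute hsymm hrow
  set M := (t • (1 : Matrix X X ℝ) - A) * centering X with hM
  have hcomm' : (t • (1 : Matrix X X ℝ) - A) * centering X =
      centering X * (t • (1 : Matrix X X ℝ) - A) := by
    simp [Matrix.sub_mul, Matrix.mul_sub, hcomm.eq]
  have hherm : M.IsHermitian := by
    rw [Matrix.IsHermitian, Matrix.conjTranspose_eq_transpose_of_trivial, hM, Matrix.transpose_mul,
      ((Matrix.isSymm_one.smul t).sub hsymm).eq, centering_isSymm.eq, hcomm']
  -- An eigenvector of `M` for `τ < 0` has zero sum and is an eigenvector of `A` for `t - τ > t`.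
  -- That eigenvalue must be the valency, which makes the vector constant, hence zero.
  have hpos : M.PosSemidef := by
    rw [hherm.posSemidef_iff_eigenvalues_nonneg]
    intro i
    by_contra! hneg
    rw [Pi.zero_apply] at hneg
    set τ := hherm.eigenvalues i with hτ
    set w : X → ℝ := ⇑(hherm.eigenvectorBasis i) with hw
    have hMw : M *ᵥ w = τ • w := hherm.mulVec_eigenvectorBasis i
    have hw0 : w ≠ 0 := by
      intro h0
      have := hherm.eigenvectorBasis.orthonormal.ne_zero i
      apply this
      ext x
      exact congrFun h0 x
    have hsum : ∑ x, w x = 0 := by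
      have h1 : ∑ x, (M *ᵥ w) x = 0 := by
        rw [hM, hcomm', ← Matrix.mulVec_mulVec]
        exact sum_centering_mulVec _
      rw [hMw] at h1
      simp only [Pi.smul_apply, smul_eq_mul, ← Finset.mul_sum] at h1
      exact (mul_eq_zero.1 h1).resolve_left hneg.ne
    have hAw : A *ᵥ w = (t - τ) • w := by
      rw [hM, ← Matrix.mulVec_mulVec, centering_mulVec_of_sum_eq_zero hsum, Matrix.sub_mulVec,
        Matrix.smul_mulVec, Matrix.one_mulVec] at hMw
      rw [sub_smul, ← hMw, sub_sub_cancel]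
    rcases ht _ (mem_spectrum_iff_exists_mulVec.2 ⟨w, hw0, hAw⟩) with h | h
    · linarith
    · have hadj : ∀ x y, G.Adj x y → w x = 1 * w y := fun x y hxy =>
        eq_mul_of_adj_of_le (k := valency G) (fun x => by rw [degree_eq_valency hG hd])
          (by norm_num) (by linarith) hAw hxy
      have hconst : ∀ x y, w x = w y := fun x y => by
        simpa using eq_pow_dist_mul hG.connected hadj x y
      apply hw0
      ext x
      have h2 : ∑ y, w y = Fintype.card X * w x := by
        rw [Finset.sum_congr rfl fun y _ => hconst y x]
        simp
      have : Nonempty X := ⟨x⟩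
      rw [hsum] at h2
      exact (mul_eq_zero.1 h2.symm).resolve_left (by simp)
  have h1 := hpos.dotProduct_mulVec_nonneg v
  rw [star_trivial, hM, ← Matrix.mulVec_mulVec, centering_mulVec_of_sum_eq_zero hv,
    Matrix.sub_mulVec, Matrix.smul_mulVec, Matrix.one_mulVec, dotProduct_sub, dotProduct_smul,
    smul_eq_mul] at h1
  linarith

omit [Fintype X] [DecidableEq X] [DecidableRel G.Adj] in
-- The first four vertices of a shortest walk: a chord or a coincidence would shorten it.
theorem exists_path_of_three_le_dist {u v : X} (h : 3 ≤ G.dist u v) :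
    ∃ x₀ x₁ x₂ x₃, G.Adj x₀ x₁ ∧ G.Adj x₁ x₂ ∧ G.Adj x₂ x₃ ∧
      ¬ G.Adj x₀ x₂ ∧ ¬ G.Adj x₁ x₃ ∧ ¬ G.Adj x₀ x₃ ∧ x₀ ≠ x₂ ∧ x₁ ≠ x₃ ∧ x₀ ≠ x₃ := by
  obtain ⟨p, hp⟩ := SimpleGraph.exists_walk_of_dist_ne_zero (by omega : G.dist u v ≠ 0)
  match p, hp with
  | .nil, hp => simp at h
  | .cons h1 .nil, hp => simp at hp; omega
  | .cons h1 (.cons h2 .nil), hp => simp at hp; omega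
  | .cons (v := b) h1 (.cons (v := c) h2 (.cons (v := d) h3 q)), hp =>
    simp only [SimpleGraph.Walk.length_cons] at hp
    refine ⟨u, b, c, d, h1, h2, h3, ?_, ?_, ?_, ?_, ?_, ?_⟩
    · intro h
      have := SimpleGraph.dist_le (.cons h (.cons h3 q))
      simp only [SimpleGraph.Walk.length_cons] at this
      omega
    · intro h
      have := SimpleGraph.dist_le (.cons h1 (.cons h q))
      simp only [SimpleGraph.Walk.length_cons] at this
      omega
    · intro h
      have := SimpleGraph.dist_le (.cons h q)
      simp only [SimpleGraph.Walk.length_cons] at this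
      omega
    · rintro rfl
      have := SimpleGraph.dist_le (.cons h3 q)
      simp only [SimpleGraph.Walk.length_cons] at this
      omega
    · rintro rfl
      have := SimpleGraph.dist_le (.cons h1 q)
      simp only [SimpleGraph.Walk.length_cons] at this
      omega
    · rintro rfl
      have := SimpleGraph.dist_le q
      omega

omit [Fintype X] [DecidableEq X] [DecidableRel G.Adj] in
theorem exists_three_le_dist (hd : 3 ≤ G.diam) : ∃ u v, 3 ≤ G.dist u v := by
  have : Nonempty X := by
    by_contra h
    rw [not_nonempty_iff] at h
    have : G.diam = 0 := SimpleGraph.diam_eq_zero.2 (Or.inr inferInstance)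
    omega
  obtain ⟨u, v, h⟩ := G.exists_dist_eq_diam
  exact ⟨u, v, h ▸ hd⟩

/-- The second largest eigenvalue of a graph of diameter at least three is positive. -/
theorem pos_of_forall_mem_spectrum_le (hG : IsDistanceRegular G) (hd : 3 ≤ G.diam) {t : ℝ}
    (ht : ∀ θ ∈ spectrum ℝ (G.adjMatrix ℝ), θ ≤ t ∨ θ = valency G) : 0 < t := by
  obtain ⟨u, v, huv⟩ := exists_three_le_dist hd
  obtain ⟨x₀, x₁, x₂, x₃, h01, h12, h23, h02, h13, h03, n02, n13, n03⟩ :=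
    exists_path_of_three_le_dist huv
  -- On the induced path the outer edges join equal signs and the middle edge opposite signs, so the
  -- quadratic form is `2 + 2 - 2 = 2 > 0`.
  set w : X → ℝ := Pi.single x₀ 1 + Pi.single x₁ 1 - Pi.single x₂ 1 - Pi.single x₃ 1 with hw
  have hsum : ∑ x, w x = 0 := by
    simp [hw, Finset.sum_add_distrib, Finset.sum_sub_distrib]
  have h1 := dotProduct_adjMatrix_mulVec_le hG (by omega) ht hsum
  have h2 : w ⬝ᵥ G.adjMatrix ℝ *ᵥ w = 2 := by
    have n : ∀ x, ¬ G.Adj x x := fun x => G.irrefl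
    simp only [hw, Matrix.mulVec_add, Matrix.mulVec_sub, dotProduct_add, dotProduct_sub,
      add_dotProduct, sub_dotProduct, single_one_dotProduct, Matrix.mulVec_single_one,
      Matrix.col_apply, SimpleGraph.adjMatrix_apply, h01, h12, h23, h02, h13, h03, n,
      G.adj_comm x₁ x₀, G.adj_comm x₂ x₁, G.adj_comm x₃ x₂, G.adj_comm x₂ x₀, G.adj_comm x₃ x₁,
      G.adj_comm x₃ x₀, if_true, if_false]
    norm_num
  have h3 : 0 ≤ w ⬝ᵥ w := Finset.sum_nonneg fun x _ => mul_self_nonneg _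
  rw [h2] at h1
  by_contra! h
  nlinarith

end Extreme

/-! ### The primitive idempotent and the normalisation of its cosines. -/

section Idempotent

variable {X : Type*} [Fintype X] [DecidableEq X]

/-- An idempotent is a projection onto its range. This is what forces `σ 0 = 1`. -/
theorem trace_eq_rank_of_mul_self_eq {E : Matrix X X ℝ} (hE : E * E = E) :
    E.trace = (E.rank : ℝ) := by
  have hproj : LinearMap.IsProj (LinearMap.range E.mulVecLin) E.mulVecLin := by
    constructor
    · exact fun v => ⟨v, rfl⟩
    · rintro _ ⟨v, rfl⟩
      simp [hE]
  have h := hproj.trace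
  rw [← Matrix.toLin'_apply', Matrix.trace_toLin'_eq] at h
  rw [h, Matrix.rank, Matrix.toLin'_apply']

variable (G : SimpleGraph X) [DecidableRel G.Adj]

theorem primitiveIdempotent_mulVec (θ : ℝ) (v : X → ℝ) :
    primitiveIdempotent G θ *ᵥ v = WithLp.ofLp
      ((Module.End.eigenspace (Matrix.toEuclideanLin (G.adjMatrix ℝ)) θ).starProjection
        (WithLp.toLp 2 v)) := by
  have h : Matrix.toEuclideanLin (primitiveIdempotent G θ) =
      ((Module.End.eigenspace (Matrix.toEuclideanLin (G.adjMatrix ℝ)) θ).starProjection :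
      EuclideanSpace ℝ X →ₗ[ℝ] EuclideanSpace ℝ X) := LinearEquiv.apply_symm_apply _ _
  have h2 := LinearMap.congr_fun h (WithLp.toLp 2 v)
  rw [ContinuousLinearMap.coe_coe] at h2
  rw [← h2]
  rfl

theorem mem_eigenspace_toEuclideanLin_iff {θ : ℝ} {v : EuclideanSpace ℝ X} :
    v ∈ Module.End.eigenspace (Matrix.toEuclideanLin (G.adjMatrix ℝ)) θ ↔
      G.adjMatrix ℝ *ᵥ v.ofLp = θ • v.ofLp := by
  rw [Module.End.mem_eigenspace_iff]
  constructor
  · intro h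
    exact congrArg WithLp.ofLp h
  · intro h
    exact WithLp.ofLp_injective 2 h

theorem adjMatrix_mul_primitiveIdempotent (θ : ℝ) :
    G.adjMatrix ℝ * primitiveIdempotent G θ = θ • primitiveIdempotent G θ := by
  apply Matrix.toLin'.injective
  apply LinearMap.ext
  intro v
  rw [map_smul, LinearMap.smul_apply]
  simp only [Matrix.toLin'_apply, ← Matrix.mulVec_mulVec, primitiveIdempotent_mulVec]
  exact (mem_eigenspace_toEuclideanLin_iff G).1 (Submodule.starProjection_apply_mem _ _)

theorem primitiveIdempotent_mul_self (θ : ℝ) :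
    primitiveIdempotent G θ * primitiveIdempotent G θ = primitiveIdempotent G θ := by
  apply Matrix.toLin'.injective
  apply LinearMap.ext
  intro v
  simp only [Matrix.toLin'_apply, ← Matrix.mulVec_mulVec, primitiveIdempotent_mulVec]
  exact congrArg WithLp.ofLp
    (Submodule.starProjection_eq_self_iff.2 (Submodule.starProjection_apply_mem _ _))

theorem primitiveIdempotent_ne_zero {θ : ℝ} (hθ : θ ∈ spectrum ℝ (G.adjMatrix ℝ)) :
    primitiveIdempotent G θ ≠ 0 := by
  intro h0
  obtain ⟨w, hw0, hw⟩ := mem_spectrum_iff_exists_mulVec.1 hθ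
  have h1 := primitiveIdempotent_mulVec G θ w
  rw [Submodule.starProjection_eq_self_iff.2 ((mem_eigenspace_toEuclideanLin_iff G).2 hw), h0,
    Matrix.zero_mulVec] at h1
  exact hw0 h1.symm

/-- The cosines `σ₀, σ₁, σ₂` of an eigenvalue. -/
theorem IsCosineSequence.eq {G : SimpleGraph X} [DecidableRel G.Adj] (hG : IsDistanceRegular G)
    (hd : 2 ≤ G.diam) {x y : X} (hxy : G.Adj x y) {θ : ℝ} (hθ : θ ∈ spectrum ℝ (G.adjMatrix ℝ))
    {σ : ℕ → ℝ} (hσ : IsCosineSequence G θ σ) :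
    valency G * σ 1 = θ ∧ 1 + a G 1 * σ 1 + b G 1 * σ 2 = θ * σ 1 := by
  set E := primitiveIdempotent G θ with hE
  have hE0 : E ≠ 0 := primitiveIdempotent_ne_zero G hθ
  have hrank := trace_eq_rank_of_mul_self_eq (primitiveIdempotent_mul_self G θ)
  rw [← hE] at hrank
  set c : ℝ := (Fintype.card X : ℝ)⁻¹ * (E.rank : ℝ) with hc
  have hentry : ∀ u v, E u v = c * σ (G.dist u v) := by
    intro u v
    have h1 := congrFun (congrFun hσ u) v
    rw [← hE, ← hc, Matrix.smul_apply, Matrix.sum_apply] at h1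
    rw [h1, smul_eq_mul]
    congr 1
    simp [distMatrix, hG.dist_le]
  have hc0 : c ≠ 0 := by
    intro h0
    apply hE0
    ext u v
    rw [hentry, h0, zero_mul, Matrix.zero_apply]
  have hn : (Fintype.card X : ℝ) ≠ 0 := fun h => hc0 (by simp [hc, h])
  have hσ0 : σ 0 = 1 := by
    have h1 : E.trace = Fintype.card X * (c * σ 0) := by
      simp [Matrix.trace, hentry]
    have h2 : (E.rank : ℝ) = Fintype.card X * c := by
      rw [hc, mul_inv_cancel_left₀ hn]
    rw [hrank, h2] at h1
    have h3 : (Fintype.card X : ℝ) * c * (σ 0 - 1) = 0 := by linarith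
    exact sub_eq_zero.1 ((mul_eq_zero.1 h3).resolve_left (mul_ne_zero hn hc0))
  have hEq : E = Matrix.of fun u v => (fun n => c * σ n) (G.dist u v) := by
    ext u v
    exact hentry u v
  have hAE := adjMatrix_mul_primitiveIdempotent G θ
  rw [← hE, hEq] at hAE
  obtain ⟨h1, h2⟩ := cosine_recurrence (g := fun n => c * σ n) hG hd hxy hAE
  rw [hσ0] at h1 h2
  constructor
  · apply mul_left_cancel₀ hc0
    linarith
  · apply mul_left_cancel₀ hc0
    linarith

end Idempotent

/-! ### The local graph and the bounds on its eigenvalues. -/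

section Local

variable {X : Type*} [Fintype X] [DecidableEq X] {G : SimpleGraph X} [DecidableRel G.Adj]

omit [DecidableEq X] in
theorem card_neighborSet (hG : IsDistanceRegular G) (hd : 1 ≤ G.diam) (x : X) :
    Fintype.card (G.neighborSet x) = valency G := by
  rw [SimpleGraph.card_neighborSet_eq_degree, degree_eq_valency hG hd]

omit [DecidableEq X] in
theorem localGraph_isRegularOfDegree (hG : IsDistanceRegular G) (hd : 2 ≤ G.diam) (x : X) :
    (localGraph G x).IsRegularOfDegree (a G 1) := by
  intro y
  rw [a, ← card_neighborFinset_filter hG hd y.2 (by omega),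
    ← SimpleGraph.card_neighborFinset_eq_degree,
    ← Finset.card_map (Function.Embedding.subtype (· ∈ G.neighborSet x))]
  congr 1
  ext z
  simp [SimpleGraph.dist_eq_one_iff_adj, and_comm]

omit [DecidableEq X] in
theorem sum_adjMatrix_localGraph (hG : IsDistanceRegular G) (hd : 2 ≤ G.diam) (x : X)
    (y : G.neighborSet x) : ∑ z, (localGraph G x).adjMatrix ℝ y z = a G 1 := by
  rw [← localGraph_isRegularOfDegree hG hd x y]
  simp only [SimpleGraph.adjMatrix_apply, ← SimpleGraph.card_neighborFinset_eq_degree,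
    SimpleGraph.neighborFinset_eq_filter, Finset.sum_boole]

/-- Each eigenvalue of the graph bounds the Rayleigh quotients of the local graph on the zero-sum
vectors. -/
theorem localGraph_dotProduct_nonneg (hG : IsDistanceRegular G) (hd : 2 ≤ G.diam)
    (hb : 0 < b G 1) {θ : ℝ} (hθ : θ ∈ spectrum ℝ (G.adjMatrix ℝ)) (x : X)
    {v : G.neighborSet x → ℝ} (hv : ∑ y, v y = 0) :
    0 ≤ (valency G - θ) * ((valency G + θ - a G 1) * (v ⬝ᵥ v) +
      (1 + θ) * (v ⬝ᵥ (localGraph G x).adjMatrix ℝ *ᵥ v)) := by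
  rcases isEmpty_or_nonempty (G.neighborSet x) with hemp | ⟨⟨y, hxy⟩⟩
  · simp [dotProduct]
  obtain ⟨g, hg0, hgA, hgpos⟩ := exists_posSemidef_of_mem_spectrum hG hθ
  obtain ⟨h1, h2⟩ := cosine_recurrence hG hd hxy hgA
  have hk := valency_eq hG hd hxy
  have hsub := (hgpos.submatrix (Subtype.val : G.neighborSet x → X)).dotProduct_mulVec_nonneg v
  -- Only the distances 0, 1 and 2 occur between neighbours of `x`; the all-ones term disappears on
  -- zero-sum vectors by `hJ`.
  have hmat : (Matrix.of fun u v => g (G.dist u v)).submatrix (Subtype.val : G.neighborSet x → X)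
      Subtype.val = (g 0 - g 2) • (1 : Matrix (G.neighborSet x) (G.neighborSet x) ℝ) +
        (g 1 - g 2) • (localGraph G x).adjMatrix ℝ + g 2 • Matrix.of fun _ _ => 1 := by
    ext u w
    have hle := dist_le_two_of_adj hG u.2 w.2
    have e1 : (localGraph G x).adjMatrix ℝ u w = if G.dist (u : X) w = 1 then 1 else 0 := by
      simp [SimpleGraph.adjMatrix_apply, SimpleGraph.dist_eq_one_iff_adj]
    have e0 : (1 : Matrix (G.neighborSet x) (G.neighborSet x) ℝ) u w =
        if G.dist (u : X) w = 0 then 1 else 0 := by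
      simp [Matrix.one_apply, hG.connected.dist_eq_zero_iff, Subtype.ext_iff]
    simp only [Matrix.submatrix_apply, Matrix.of_apply, Matrix.add_apply, Matrix.smul_apply,
      smul_eq_mul, e0, e1]
    generalize G.dist (u : X) w = n at *
    interval_cases n <;> simp
  have hJ : v ⬝ᵥ (Matrix.of fun _ _ => (1 : ℝ) : Matrix (G.neighborSet x) (G.neighborSet x) ℝ) *ᵥ v
      = 0 := by
    simp [Matrix.mulVec, dotProduct, hv]
  rw [star_trivial, hmat] at hsub
  simp only [Matrix.add_mulVec, Matrix.smul_mulVec, Matrix.one_mulVec, dotProduct_add,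
    dotProduct_smul, smul_eq_mul, hJ, mul_zero, add_zero] at hsub
  set N := v ⬝ᵥ v
  set T := v ⬝ᵥ (localGraph G x).adjMatrix ℝ *ᵥ v
  have hb' : (0 : ℝ) < b G 1 := by exact_mod_cast hb
  have hk0 : (0 : ℝ) < valency G := by
    rw [hk]
    positivity
  have e1 : (valency G : ℝ) * b G 1 * (g 0 - g 2) =
      g 0 * ((valency G - θ) * (valency G + θ - a G 1)) := by
    linear_combination (-(valency G : ℝ)) * h2 - (θ - a G 1) * h1 - valency G * g 0 * hk
  have e2 : (valency G : ℝ) * b G 1 * (g 1 - g 2) = g 0 * ((valency G - θ) * (1 + θ)) := by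
    linear_combination (-(valency G : ℝ)) * h2 + (b G 1 + a G 1 - θ) * h1 - θ * g 0 * hk
  have e3 : 0 ≤ g 0 * ((valency G - θ) * ((valency G + θ - a G 1) * N + (1 + θ) * T)) := by
    have h := mul_nonneg (mul_pos hk0 hb').le hsub
    calc (0 : ℝ) ≤ _ := h
      _ = _ := by linear_combination N * e1 + T * e2
  exact nonneg_of_mul_nonneg_right e3 hg0

omit [DecidableEq X] in
theorem b_one_pos (hG : IsDistanceRegular G) (hd : 3 ≤ G.diam) : 0 < b G 1 := by
  obtain ⟨u, v, huv⟩ := exists_three_le_dist hd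
  obtain ⟨x₀, x₁, x₂, x₃, h01, h12, -, h02, -, -, n02, -, -⟩ := exists_path_of_three_le_dist huv
  rw [b, ← card_neighborFinset_filter hG (by omega) h01.symm le_rfl, Finset.card_pos]
  refine ⟨x₂, ?_⟩
  rw [Finset.mem_filter, SimpleGraph.mem_neighborFinset]
  refine ⟨h12, ?_⟩
  have h1 := dist_le_two_of_adj hG h01.symm h12
  have h2 : G.dist x₀ x₂ ≠ 0 := fun h => n02 (hG.connected.dist_eq_zero_iff.1 h)
  have h3 : G.dist x₀ x₂ ≠ 1 := fun h => h02 (SimpleGraph.dist_eq_one_iff_adj.1 h)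
  change G.dist x₀ x₂ = 2
  omega

omit [Fintype X] [DecidableEq X] [DecidableRel G.Adj] in
-- `IsTight` brings its own enumeration of the spectrum; this identifies it with the given one.
theorem strictAntiOn_Iic_unique {d : ℕ} {f g : ℕ → ℝ} (hf : StrictAntiOn f (Set.Iic d))
    (hg : StrictAntiOn g (Set.Iic d)) (h : f '' Set.Iic d = g '' Set.Iic d) {i : ℕ}
    (hi : i ≤ d) : f i = g i := by
  have h1 : StrictMono (fun i : Set.Iic d => OrderDual.toDual (f i)) := fun i j hij =>
    hf i.2 j.2 hij
  have h2 : StrictMono (fun i : Set.Iic d => OrderDual.toDual (g i)) := fun i j hij =>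
    hg i.2 j.2 hij
  have h3 : Set.range (fun i : Set.Iic d => OrderDual.toDual (f i)) =
      Set.range (fun i : Set.Iic d => OrderDual.toDual (g i)) := by
    have : ∀ e : ℕ → ℝ, Set.range (fun i : Set.Iic d => OrderDual.toDual (e i)) =
        OrderDual.toDual '' (e '' Set.Iic d) := fun e => by
      ext t
      simp only [Set.mem_range, Subtype.exists, Set.mem_Iic, Set.mem_image]
      simp
    rw [this, this, h]
  exact congrFun ((h1.range_inj h2).1 h3) ⟨i, hi⟩

theorem card_commonNeighbors_eq {V : Type*} [Fintype V] [DecidableEq V] (H : SimpleGraph V)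
    [DecidableRel H.Adj] (y z : V) :
    (Fintype.card (H.commonNeighbors y z) : ℝ) = (H.adjMatrix ℝ * H.adjMatrix ℝ) y z := by
  have : (H.adjMatrix ℝ * H.adjMatrix ℝ) y z = (H.commonNeighbors y z).toFinset.card := by
    rw [Matrix.mul_apply]
    simp only [SimpleGraph.adjMatrix_apply, ite_mul, one_mul, zero_mul, ← ite_and,
      Finset.sum_boole]
    congr 2
    ext w
    simp [SimpleGraph.mem_commonNeighbors, H.adj_comm z w]
  rw [this, Set.toFinset_card]

end Local

/-! ### Algebra of the tight relation. -/

section Parameters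

/-- The relations between the valency `k`, the numbers `a = a₁`, `b = b₁` and the eigenvalues
`θ, θ'` of a tight distance-regular graph that determine the local parameters. -/
structure TightParameters (k a b θ θ' : ℝ) : Prop where
  k_eq : k = 1 + a + b
  a_pos : 0 < a
  b_pos : 0 < b
  ne_k : k - θ ≠ 0
  ne_neg_k : k + θ ≠ 0
  ne_neg_one : 1 + θ ≠ 0
  ne' : θ - θ' ≠ 0
  ne_zero' : θ' ≠ 0
  ne : (a + 1) * θ + k ≠ 0
  tight : ((a + 1) * θ + k) * θ' = -(k * (k + θ - a))

namespace TightParameters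

variable {k a b θ θ' : ℝ}

theorem k_pos (h : TightParameters k a b θ θ') : 0 < k := by
  rw [h.k_eq]
  linarith [h.a_pos, h.b_pos]

theorem add_sub_ne_zero (h : TightParameters k a b θ θ') : k + θ - a ≠ 0 := by
  intro h0
  have h1 := h.tight
  rw [h0, mul_zero, neg_zero] at h1
  exact mul_ne_zero h.ne h.ne_zero' h1

/-- The left side, free of `θ'`, is the common denominator of `ε` and of both multiplicities; the
factorization shows that it is nonzero. -/
theorem den_eq (h : TightParameters k a b θ θ') :
    (k + θ) ^ 2 + a * (θ ^ 2 - k) = ((a + 1) * θ + k) * (θ - θ') := by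
  linear_combination h.tight

theorem den_ne_zero (h : TightParameters k a b θ θ') : (k + θ) ^ 2 + a * (θ ^ 2 - k) ≠ 0 := by
  rw [h.den_eq]
  exact mul_ne_zero h.ne h.ne'

theorem auxiliary_eq (h : TightParameters k a b θ θ') :
    (k ^ 2 - θ * θ') / (k * (θ - θ')) =
      ((k + θ) ^ 2 + a * θ * (k - 1)) / ((k + θ) ^ 2 + a * (θ ^ 2 - k)) := by
  have hk := h.k_pos.ne'
  rw [div_eq_div_iff (mul_ne_zero hk h.ne') h.den_ne_zero, h.den_eq]
  linear_combination (-(θ - θ') * θ) * h.tight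

variable {σ₁ σ₂ ε : ℝ}

theorem one_add (h : TightParameters k a b θ θ') (h1 : k * σ₁ = θ) :
    1 + σ₁ = (k + θ) / k := by
  have hk := h.k_pos.ne'
  field_simp
  linarith

theorem one_sub (h : TightParameters k a b θ θ') (h1 : k * σ₁ = θ)
    (h2 : 1 + a * σ₁ + b * σ₂ = θ * σ₁) : 1 - σ₂ = (k - θ) * (k + θ - a) / (k * b) := by
  have hk := h.k_pos.ne'
  have hb := h.b_pos.ne'
  field_simp
  linear_combination (-k) * h2 - (θ - a) * h1 - k * h.k_eq

theorem sub_eq (h : TightParameters k a b θ θ') (h1 : k * σ₁ = θ)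
    (h2 : 1 + a * σ₁ + b * σ₂ = θ * σ₁) : σ₁ - σ₂ = (k - θ) * (1 + θ) / (k * b) := by
  have hk := h.k_pos.ne'
  have hb := h.b_pos.ne'
  field_simp
  linear_combination (-k) * h2 + (b + a - θ) * h1 - θ * h.k_eq

theorem sub_sq (h : TightParameters k a b θ θ') (h1 : k * σ₁ = θ)
    (h2 : 1 + a * σ₁ + b * σ₂ = θ * σ₁) :
    σ₂ - σ₁ ^ 2 = -((k - θ) * ((a + 1) * θ + k) / (k ^ 2 * b)) := by
  have hk := h.k_pos.ne'
  have hb := h.b_pos.ne'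
  subst h1
  field_simp at h2 ⊢
  linear_combination h2 + σ₁ ^ 2 * h.k_eq

theorem one_sub_aux (h : TightParameters k a b θ θ')
    (hε : ε = (k ^ 2 - θ * θ') / (k * (θ - θ'))) :
    1 - ε = -(a * (k - θ) * (1 + θ) / ((k + θ) ^ 2 + a * (θ ^ 2 - k))) := by
  have hden := h.den_ne_zero
  rw [hε, h.auxiliary_eq]
  field_simp
  ring

theorem one_sub_aux_mul (h : TightParameters k a b θ θ') (h1 : k * σ₁ = θ)
    (hε : ε = (k ^ 2 - θ * θ') / (k * (θ - θ'))) :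
    1 - ε * σ₁ =
      (k - θ) * (k + θ) * (k + θ - a) / (k * ((k + θ) ^ 2 + a * (θ ^ 2 - k))) := by
  have hk := h.k_pos.ne'
  have hden := h.den_ne_zero
  rw [hε, h.auxiliary_eq, eq_div_of_mul_eq hk ((mul_comm _ _).trans h1)]
  field_simp
  ring

theorem sub_aux (h : TightParameters k a b θ θ') (h1 : k * σ₁ = θ)
    (hε : ε = (k ^ 2 - θ * θ') / (k * (θ - θ'))) :
    σ₁ - ε = -((k - θ) * (k + θ) * ((a + 1) * θ + k) /
      (k * ((k + θ) ^ 2 + a * (θ ^ 2 - k)))) := by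
  have hk := h.k_pos.ne'
  have hden := h.den_ne_zero
  rw [hε, h.auxiliary_eq, eq_div_of_mul_eq hk ((mul_comm _ _).trans h1)]
  field_simp
  ring

theorem two_sub_aux_mul (h : TightParameters k a b θ θ') (h1 : k * σ₁ = θ)
    (h2 : 1 + a * σ₁ + b * σ₂ = θ * σ₁)
    (hε : ε = (k ^ 2 - θ * θ') / (k * (θ - θ'))) :
    σ₂ - ε * σ₁ = -((1 + θ) * ((a + 1) * θ + k) * (k - θ) * (k + θ - a) /
      (k * b * ((k + θ) ^ 2 + a * (θ ^ 2 - k)))) := by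
  have hk := h.k_pos.ne'
  have hb := h.b_pos.ne'
  have e : σ₂ - ε * σ₁ = (1 - ε * σ₁) - (1 - σ₂) := by ring
  have hden := h.den_ne_zero
  rw [e, h.one_sub_aux_mul h1 hε, h.one_sub h1 h2]
  field_simp
  rw [h.k_eq]
  ring

theorem r_eq (h : TightParameters k a b θ θ') (h1 : k * σ₁ = θ) :
    a * σ₁ / (1 + σ₁) = a * θ / (k + θ) := by
  have hk := h.k_pos.ne'
  have hk' := h.ne_neg_k
  rw [h.one_add h1, ← h1]
  rw [← h1] at hk'
  field_simp

theorem s_eq (h : TightParameters k a b θ θ') (h1 : k * σ₁ = θ)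
    (h2 : 1 + a * σ₁ + b * σ₂ = θ * σ₁) :
    -((1 - σ₂) / (σ₁ - σ₂)) = -((k + θ - a) / (1 + θ)) := by
  have hk := h.k_pos.ne'
  have hb := h.b_pos.ne'
  have h3 := h.ne_k
  have h4 := h.ne_neg_one
  rw [h.one_sub h1 h2, h.sub_eq h1 h2]
  field_simp

/-- The cross-multiplied equation is the tight relation. So `r` is the local bound coming from `θ'`,
just as `s` is the one coming from `θ`. -/
theorem r_eq_conj (h : TightParameters k a b θ θ') :
    a * θ / (k + θ) = -((k + θ' - a) / (1 + θ')) := by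
  have h1 := h.ne_neg_k
  have h2 : 1 + θ' ≠ 0 := by
    intro h0
    have h3 : θ' = -1 := by linarith
    have h4 := h.tight
    rw [h3] at h4
    have h5 : b * (k + θ) = 0 := by linear_combination h4 - (k + θ) * h.k_eq
    exact mul_ne_zero h.b_pos.ne' h1 h5
  field_simp
  linear_combination h.tight

theorem r_sub_s (h : TightParameters k a b θ θ') :
    a * θ / (k + θ) - -((k + θ - a) / (1 + θ)) =
      ((k + θ) ^ 2 + a * (θ ^ 2 - k)) / ((k + θ) * (1 + θ)) := by
  have h1 := h.ne_neg_k
  have h2 := h.ne_neg_one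
  field_simp
  ring

theorem a_ne_r (h : TightParameters k a b θ θ') : a ≠ a * θ / (k + θ) := by
  intro h0
  have h1 := h.ne_neg_k
  field_simp at h0
  have := h.k_pos
  have := h.a_pos
  nlinarith

theorem a_ne_s (h : TightParameters k a b θ θ') : a ≠ -((k + θ - a) / (1 + θ)) := by
  intro h0
  have h1 := h.ne_neg_one
  rw [← neg_div, eq_div_iff h1] at h0
  exact h.ne (by linarith)

theorem r_ne_s (h : TightParameters k a b θ θ') :
    a * θ / (k + θ) ≠ -((k + θ - a) / (1 + θ)) := by
  rw [← sub_ne_zero, h.r_sub_s]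
  exact div_ne_zero h.den_ne_zero (mul_ne_zero h.ne_neg_k h.ne_neg_one)

/-- The condition that the squared deviations of the local eigenvalues add up to zero. -/
theorem trace_identity (h : TightParameters k a b θ θ') {r s : ℝ} (hr : r = a * θ / (k + θ))
    (hs : s = -((k + θ - a) / (1 + θ))) : k * a + r * s * k = (a - r) * (a - s) := by
  have h1 := h.ne_neg_k
  have h2 := h.ne_neg_one
  subst hr hs
  field_simp
  ring

theorem mult_r_eq (h : TightParameters k a b θ θ') (h1 : k * σ₁ = θ)
    (h2 : 1 + a * σ₁ + b * σ₂ = θ * σ₁) (hε : ε = (k ^ 2 - θ * θ') / (k * (θ - θ')))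
    {r s : ℝ} (hr : r = a * θ / (k + θ)) (hs : s = -((k + θ - a) / (1 + θ))) :
    -(s * (k - 1) + a) / (r - s) = (1 + σ₁) * (σ₁ - ε) / (σ₂ - σ₁ ^ 2) := by
  have e1 := h.ne_neg_k
  have e2 := h.ne_neg_one
  have e3 := h.ne_k
  have e4 := h.den_ne_zero
  have e5 : θ * (a + 1) + k ≠ 0 := by
    rw [mul_comm]
    exact h.ne
  have hk := h.k_pos.ne'
  have hb := h.b_pos.ne'
  have l : -(s * (k - 1) + a) / (r - s) =
      b * (k + θ) ^ 2 / ((k + θ) ^ 2 + a * (θ ^ 2 - k)) := by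
    rw [hr, hs, h.r_sub_s]
    field_simp
    rw [h.k_eq]
    ring
  rw [l, h.one_add h1, h.sub_aux h1 hε, h.sub_sq h1 h2]
  field_simp

theorem mult_r_ne_zero (h : TightParameters k a b θ θ') (h1 : k * σ₁ = θ)
    (h2 : 1 + a * σ₁ + b * σ₂ = θ * σ₁) (hε : ε = (k ^ 2 - θ * θ') / (k * (θ - θ'))) :
    (1 + σ₁) * (σ₁ - ε) / (σ₂ - σ₁ ^ 2) ≠ 0 := by
  have e1 := h.ne_neg_k
  have e3 := h.ne_k
  have e4 := h.den_ne_zero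
  have e5 := h.ne
  have hk := h.k_pos.ne'
  have hb := h.b_pos.ne'
  rw [h.one_add h1, h.sub_aux h1 hε, h.sub_sq h1 h2]
  refine div_ne_zero (mul_ne_zero (div_ne_zero e1 hk) (neg_ne_zero.2 ?_)) (neg_ne_zero.2 ?_)
  · exact div_ne_zero (mul_ne_zero (mul_ne_zero e3 e1) e5) (mul_ne_zero hk e4)
  · exact div_ne_zero (mul_ne_zero e3 e5) (mul_ne_zero (pow_ne_zero 2 hk) hb)

theorem mult_s_eq (h : TightParameters k a b θ θ') (h1 : k * σ₁ = θ)
    (h2 : 1 + a * σ₁ + b * σ₂ = θ * σ₁) (hε : ε = (k ^ 2 - θ * θ') / (k * (θ - θ')))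
    {r s : ℝ} (hr : r = a * θ / (k + θ)) (hs : s = -((k + θ - a) / (1 + θ))) :
    -(r * (k - 1) + a) / (s - r) =
      -((1 - ε) * (1 + σ₁) * (σ₂ - ε * σ₁)) / ((σ₂ - σ₁ ^ 2) * (1 - ε * σ₁)) := by
  have e1 := h.ne_neg_k
  have e2 := h.ne_neg_one
  have e3 := h.ne_k
  have e4 := h.den_ne_zero
  have e5 : θ * (a + 1) + k ≠ 0 := by
    rw [mul_comm]
    exact h.ne
  have e6 := h.add_sub_ne_zero
  have hk := h.k_pos.ne'
  have hb := h.b_pos.ne'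
  have l : -(r * (k - 1) + a) / (s - r) =
      a * k * (1 + θ) ^ 2 / ((k + θ) ^ 2 + a * (θ ^ 2 - k)) := by
    rw [← neg_sub r s, neg_div_neg_eq, hr, hs, h.r_sub_s]
    field_simp
    ring
  rw [l, h.one_add h1, h.one_sub_aux hε, h.one_sub_aux_mul h1 hε, h.two_sub_aux_mul h1 h2 hε,
    h.sub_sq h1 h2]
  field_simp

theorem mult_s_ne_zero (h : TightParameters k a b θ θ') {r s : ℝ} (hr : r = a * θ / (k + θ))
    (hs : s = -((k + θ - a) / (1 + θ))) : -(r * (k - 1) + a) / (s - r) ≠ 0 := by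
  have e1 := h.ne_neg_k
  have hk := h.k_pos.ne'
  have e : r * (k - 1) + a = a * k * (1 + θ) / (k + θ) := by
    rw [hr]
    field_simp
    ring
  refine div_ne_zero (neg_ne_zero.2 ?_) (sub_ne_zero.2 ?_)
  · rw [e]
    exact div_ne_zero (mul_ne_zero (mul_ne_zero h.a_pos.ne' hk) h.ne_neg_one) e1
  · rw [hr, hs]
    exact h.r_ne_s.symm

theorem a_eq (h : TightParameters k a b θ θ') (h1 : k * σ₁ = θ)
    (h2 : 1 + a * σ₁ + b * σ₂ = θ * σ₁) (hε : ε = (k ^ 2 - θ * θ') / (k * (θ - θ'))) :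
    a = -((1 - σ₂) * (1 + σ₁) * (1 - ε)) / ((σ₁ - σ₂) * (1 - ε * σ₁)) := by
  have e1 := h.ne_neg_k
  have e2 := h.ne_neg_one
  have e3 := h.ne_k
  have e4 := h.den_ne_zero
  have e6 := h.add_sub_ne_zero
  have hk := h.k_pos.ne'
  have hb := h.b_pos.ne'
  rw [h.one_add h1, h.one_sub_aux hε, h.one_sub_aux_mul h1 hε, h.one_sub h1 h2, h.sub_eq h1 h2]
  field_simp

theorem denominators_ne_zero (h : TightParameters k a b θ θ') (h1 : k * σ₁ = θ)
    (h2 : 1 + a * σ₁ + b * σ₂ = θ * σ₁) (hε : ε = (k ^ 2 - θ * θ') / (k * (θ - θ'))) :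
    1 + σ₁ ≠ 0 ∧ σ₁ - σ₂ ≠ 0 ∧ σ₂ - σ₁ ^ 2 ≠ 0 ∧ 1 - ε * σ₁ ≠ 0 := by
  have hk := h.k_pos.ne'
  have hb := h.b_pos.ne'
  refine ⟨?_, ?_, ?_, ?_⟩
  · rw [h.one_add h1]
    exact div_ne_zero h.ne_neg_k hk
  · rw [h.sub_eq h1 h2]
    exact div_ne_zero (mul_ne_zero h.ne_k h.ne_neg_one) (mul_ne_zero hk hb)
  · rw [h.sub_sq h1 h2]
    exact neg_ne_zero.2
      (div_ne_zero (mul_ne_zero h.ne_k h.ne) (mul_ne_zero (pow_ne_zero 2 hk) hb))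
  · rw [h.one_sub_aux_mul h1 hε]
    exact div_ne_zero (mul_ne_zero (mul_ne_zero h.ne_k h.ne_neg_k) h.add_sub_ne_zero)
      (mul_ne_zero hk h.den_ne_zero)

end TightParameters

end Parameters

/-! ### Tightness forces two local eigenvalues on zero-sum vectors. -/

section Tight

variable {X : Type*} [Fintype X] [DecidableEq X] {G : SimpleGraph X} [DecidableRel G.Adj]

/-- The position of the extreme eigenvalues of a tight distance-regular graph. -/
theorem IsTight.extreme_eigenvalues (hG : IsDistanceRegular G) (hd : 3 ≤ G.diam)
    (htight : IsTight G) {ev : ℕ → ℝ} (hev : IsEigenvalueSequence G ev) :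
    0 < ev 1 ∧ ev 1 < valency G ∧ ev G.diam < -1 ∧ -(valency G : ℝ) < ev G.diam ∧
      (0 : ℝ) < a G 1 ∧ (valency G : ℝ) = 1 + a G 1 + b G 1 ∧
      (((a G 1 : ℝ) + 1) * ev 1 + valency G) * (((a G 1 : ℝ) + 1) * ev G.diam + valency G) =
        -(valency G * a G 1 * b G 1) := by
  obtain ⟨hnb, φ, hφ, hT⟩ := htight
  have heq : ∀ i ≤ G.diam, φ i = ev i := fun i hi =>
    strictAntiOn_Iic_unique hφ.1 hev.1 (hφ.2.trans hev.2.symm) hi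
  rw [heq 1 (by omega), heq G.diam le_rfl] at hT
  have hmem : ∀ i ≤ G.diam, ev i ∈ spectrum ℝ (G.adjMatrix ℝ) := fun i hi => by
    rw [← hev.2]
    exact ⟨i, hi, rfl⟩
  have h0k : ev 0 ≤ valency G := le_valency_of_mem_spectrum hG (by omega) (hmem 0 (by omega))
  have hanti : ∀ i j, i < j → j ≤ G.diam → ev j < ev i := fun i j hij hj =>
    hev.1 (Set.mem_Iic.2 (by omega)) (Set.mem_Iic.2 hj) hij
  have h1k : ev 1 < valency G := (hanti 0 1 (by omega) (by omega)).trans_le h0k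
  have hk0 : ev 0 = valency G := by
    refine le_antisymm h0k ?_
    have h := valency_mem_spectrum hG (by omega)
    rw [← hev.2] at h
    obtain ⟨i, hi, hik⟩ := h
    rw [← hik]
    rcases Nat.eq_zero_or_pos i with rfl | hpos
    · exact le_rfl
    · exact (hanti 0 i hpos hi).le
  have h1pos : 0 < ev 1 := by
    refine pos_of_forall_mem_spectrum_le hG hd fun θ hθ => ?_
    rw [← hev.2] at hθ
    obtain ⟨i, hi, rfl⟩ := hθ
    rcases Nat.eq_zero_or_pos i with rfl | hpos
    · exact Or.inr hk0
    · rcases Nat.eq_or_lt_of_le hpos with h | h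
      · exact Or.inl (by rw [← h])
      · exact Or.inl (hanti 1 i h hi).le
  have hdk : -(valency G : ℝ) < ev G.diam := by
    by_contra! h
    exact hnb (bipartite_of_le_neg_valency hG (by omega) (hmem _ le_rfl) h)
  obtain ⟨u, v, huv⟩ := exists_three_le_dist hd
  obtain ⟨x₀, x₁, -, -, h01, -⟩ := exists_path_of_three_le_dist huv
  have hk := valency_eq hG (by omega) h01
  have hb : (0 : ℝ) < b G 1 := by exact_mod_cast b_one_pos hG hd
  have ha0 : (0 : ℝ) ≤ a G 1 := Nat.cast_nonneg _
  have ha1 : (0 : ℝ) < a G 1 + 1 := by linarith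
  have hT' : (((a G 1 : ℝ) + 1) * ev 1 + valency G) *
      (((a G 1 : ℝ) + 1) * ev G.diam + valency G) = -(valency G * a G 1 * b G 1) := by
    have h2 := hT
    field_simp at h2
    linarith
  have hkpos : (0 : ℝ) < valency G := by linarith
  have hD : 0 < ((a G 1 : ℝ) + 1) * ev 1 + valency G := by positivity
  -- If `a₁ = 0`, the tight equation forces `θ_d = -k`, which is excluded since the graph is not
  -- bipartite.
  have hapos : (0 : ℝ) < a G 1 := by
    rcases ha0.lt_or_eq with h | h
    · exact h
    · rw [← h] at hT' hD
      have h3 : (0 + 1) * ev G.diam + (valency G : ℝ) = 0 := by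
        refine (mul_eq_zero.1 ?_).resolve_left hD.ne'
        rw [hT']
        ring
      linarith
  refine ⟨h1pos, h1k, ?_, hdk, hapos, hk, hT'⟩
  -- This gives `θ_d < -k / (a₁ + 1)`, which is below `-1` because `k = 1 + a₁ + b₁` with `b₁ > 0`.
  have h4 : ((a G 1 : ℝ) + 1) * ev G.diam + valency G < 0 := by
    by_contra! h
    have h5 := mul_nonneg hD.le h
    rw [hT'] at h5
    have : 0 < (valency G : ℝ) * a G 1 * b G 1 := by positivity
    linarith
  by_contra! h
  nlinarith

theorem IsTight.tightParameters (hG : IsDistanceRegular G) (hd : 3 ≤ G.diam)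
    (htight : IsTight G) {ev : ℕ → ℝ} (hev : IsEigenvalueSequence G ev) {θ θ' : ℝ}
    (hθ : (θ = ev 1 ∧ θ' = ev G.diam) ∨ (θ = ev G.diam ∧ θ' = ev 1)) :
    TightParameters (valency G) (a G 1) (b G 1) θ θ' := by
  obtain ⟨h1, h2, h3, h4, h5, h6, h7⟩ := htight.extreme_eigenvalues hG hd hev
  have hb : (0 : ℝ) < b G 1 := by exact_mod_cast b_one_pos hG hd
  have hne : ∀ t u : ℝ, (((a G 1 : ℝ) + 1) * t + valency G) * (((a G 1 : ℝ) + 1) * u + valency G) =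
        -(valency G * a G 1 * b G 1) → ((a G 1 : ℝ) + 1) * t + valency G ≠ 0 ∧
        (((a G 1 : ℝ) + 1) * t + valency G) * u = -(valency G * (valency G + t - a G 1)) := by
    intro t u h
    constructor
    · intro h0
      rw [h0, zero_mul] at h
      have : 0 < (valency G : ℝ) * a G 1 * b G 1 := by
        have : (0 : ℝ) < valency G := by linarith
        positivity
      linarith
    · have ha : (a G 1 : ℝ) + 1 ≠ 0 := by linarith
      apply mul_left_cancel₀ ha
      -- Since `k = 1 + a₁ + b₁`, one has `a₁ b₁ + k = (a₁ + 1) (k - a₁)`, so a factor `a₁ + 1`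
      -- cancels.
      linear_combination h + (valency G * a G 1 : ℝ) * h6
  rcases hθ with ⟨rfl, rfl⟩ | ⟨rfl, rfl⟩
  · obtain ⟨h8, h9⟩ := hne _ _ h7
    exact ⟨h6, h5, hb, by linarith, by linarith, by linarith, by linarith, by linarith, h8, h9⟩
  · obtain ⟨h8, h9⟩ := hne _ _ ((mul_comm _ _).trans h7)
    exact ⟨h6, h5, hb, by linarith, by linarith, by linarith, by linarith, by linarith, h8, h9⟩

/-- The local graph of a tight graph has at most two eigenvalues on the zero-sum vectors. -/
theorem IsTight.localGraph_mul_centering_eq_zero (hG : IsDistanceRegular G) (hd : 3 ≤ G.diam)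
    (htight : IsTight G) {ev : ℕ → ℝ} (hev : IsEigenvalueSequence G ev) {θ θ' : ℝ}
    (hθ : (θ = ev 1 ∧ θ' = ev G.diam) ∨ (θ = ev G.diam ∧ θ' = ev 1)) (x : X) {r s : ℝ}
    (hr : r = a G 1 * θ / (valency G + θ))
    (hs : s = -((valency G + θ - a G 1) / (1 + θ))) :
    ((localGraph G x).adjMatrix ℝ - r • (1 : Matrix (G.neighborSet x) (G.neighborSet x) ℝ)) *
      ((localGraph G x).adjMatrix ℝ - s • (1 : Matrix (G.neighborSet x) (G.neighborSet x) ℝ)) *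
      centering (G.neighborSet x) = 0 := by
  obtain ⟨h1, h2, h3, h4, h5, h6, -⟩ := htight.extreme_eigenvalues hG hd hev
  have hpar := htight.tightParameters hG hd hev hθ
  have hb := b_one_pos hG hd
  have hb' : (0 : ℝ) < b G 1 := by exact_mod_cast hb
  set B := (localGraph G x).adjMatrix ℝ with hB
  set p : ℝ := -((valency G + ev 1 - a G 1) / (1 + ev 1)) with hp
  set q : ℝ := -((valency G + ev G.diam - a G 1) / (1 + ev G.diam)) with hq
  have hmem : ∀ i ≤ G.diam, ev i ∈ spectrum ℝ (G.adjMatrix ℝ) := fun i hi => by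
    rw [← hev.2]
    exact ⟨i, hi, rfl⟩
  have hpairs : (r = q ∧ s = p) ∨ (r = p ∧ s = q) := by
    have hr' := hr.trans hpar.r_eq_conj
    rcases hθ with ⟨rfl, rfl⟩ | ⟨rfl, rfl⟩
    · exact Or.inl ⟨hr', hs⟩
    · exact Or.inr ⟨hr', hs⟩
  have hcard : (Fintype.card (G.neighborSet x) : ℝ) = valency G := by
    exact_mod_cast card_neighborSet hG (by omega) x
  have hne : Nonempty (G.neighborSet x) := by
    rw [← Fintype.card_pos_iff]
    have : (0 : ℝ) < Fintype.card (G.neighborSet x) := by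
      rw [hcard]
      exact hpar.k_pos
    exact_mod_cast this
  -- The value `-1` separates the bounds: `k - a₁ > 1`, while `1 + θ₁` and `1 + θ_d` have opposite
  -- signs.
  have hpq : p < q := by
    have e1 : p < -1 := by
      rw [hp, neg_lt_neg_iff, lt_div_iff₀ (by linarith)]
      linarith
    have e2 : -1 < q := by
      rw [hq, neg_lt_neg_iff, div_lt_iff_of_neg (by linarith)]
      linarith
    linarith
  have hzero : (B - p • (1 : Matrix (G.neighborSet x) (G.neighborSet x) ℝ)) *
      (B - q • (1 : Matrix (G.neighborSet x) (G.neighborSet x) ℝ)) *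
      centering (G.neighborSet x) = 0 := by
    refine sub_mul_sub_mul_centering_eq_zero (localGraph G x).isSymm_adjMatrix
      (sum_adjMatrix_localGraph hG (by omega) x) hpq ?_ ?_ ?_
    · intro v hv
      have h := localGraph_dotProduct_nonneg hG (by omega) hb (hmem 1 (by omega)) x hv
      have h' := nonneg_of_mul_nonneg_right h (by linarith)
      rw [hp, ← neg_div, div_mul_eq_mul_div, div_le_iff₀ (by linarith)]
      linarith
    · intro v hv
      have h := localGraph_dotProduct_nonneg hG (by omega) hb (hmem _ le_rfl) x hv
      have h' := nonneg_of_mul_nonneg_right h (by linarith)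
      rw [hq, ← neg_div, div_mul_eq_mul_div, le_div_iff_of_neg (by linarith)]
      linarith
    · have htr : (B * B).trace = valency G * a G 1 := by
        rw [← hcard]
        simp only [Matrix.trace, Matrix.diag_apply, hB, SimpleGraph.adjMatrix_mul_self_apply_self,
          localGraph_isRegularOfDegree hG (by omega : 2 ≤ G.diam) x _, Finset.sum_const,
          Finset.card_univ, nsmul_eq_mul]
      -- A rational identity in `θ`, symmetric in `r` and `s`; tightness enters through `hpairs`,
      -- which makes it a statement about `p` and `q`.
      have hid := hpar.trace_identity hr hs
      rw [htr, SimpleGraph.trace_adjMatrix, hcard]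
      rcases hpairs with ⟨h, h'⟩ | ⟨h, h'⟩ <;> rw [h, h'] at hid <;> linarith
  rcases hpairs with ⟨h, h'⟩ | ⟨h, h'⟩
  · rw [h, h', ← hzero]
    congr 1
    simp only [Matrix.sub_mul, Matrix.mul_sub, Matrix.smul_mul, Matrix.mul_smul, Matrix.one_mul,
      Matrix.mul_one, smul_sub, smul_smul, mul_comm q p]
    abel
  · rw [h, h', hzero]

end Tight

/-! ### From the quadratic relation to strong regularity and the spectrum. -/

section Final

variable {V : Type*} [Fintype V] [DecidableEq V]

/-- A regular graph whose adjacency matrix has at most two eigenvalues on the zero-sum vectors is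
strongly regular. -/
theorem isSRGWith_of_mul_centering_eq_zero [Nonempty V] {H : SimpleGraph V} [DecidableRel H.Adj]
    {a : ℕ} (hreg : H.IsRegularOfDegree a) (ha : 0 < a) (hcard : a + 1 < Fintype.card V) {r s : ℝ}
    (h : (H.adjMatrix ℝ - r • (1 : Matrix V V ℝ)) * (H.adjMatrix ℝ - s • (1 : Matrix V V ℝ)) *
      centering V = 0) :
    ∃ lam mu : ℕ, H.IsSRGWith (Fintype.card V) a lam mu ∧
      (lam : ℝ) = r + s + a + r * s ∧ (mu : ℝ) = a + r * s := by
  have hrow : ∀ y, ∑ z, H.adjMatrix ℝ y z = a := fun y => by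
    rw [← hreg y]
    simp [SimpleGraph.adjMatrix_apply, ← SimpleGraph.neighborFinset_eq_filter]
  have hsq := mul_self_apply_of_mul_centering_eq_zero hrow h
  set c := ((a : ℝ) - r) * (a - s) / Fintype.card V with hc
  have y₀ : V := Classical.arbitrary V
  -- A diagonal entry of the square of the adjacency matrix is the degree, which determines the
  -- constant.
  have hca : c = a + r * s := by
    have := hsq y₀ y₀
    rw [SimpleGraph.adjMatrix_mul_self_apply_self, hreg y₀] at this
    simp at this
    linarith
  rw [hca] at hsq
  have hadj : ∀ y z, H.Adj y z →
      (Fintype.card (H.commonNeighbors y z) : ℝ) = r + s + a + r * s := fun y z hyz => by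
    rw [card_commonNeighbors_eq, hsq, SimpleGraph.adjMatrix_apply, if_pos hyz,
      Matrix.one_apply_ne hyz.ne]
    ring
  have hnadj : ∀ y z, y ≠ z → ¬ H.Adj y z →
      (Fintype.card (H.commonNeighbors y z) : ℝ) = a + r * s := fun y z hne hyz => by
    rw [card_commonNeighbors_eq, hsq, SimpleGraph.adjMatrix_apply, if_neg hyz,
      Matrix.one_apply_ne hne]
    ring
  obtain ⟨y₁, hy₁⟩ : ∃ z, H.Adj y₀ z := by
    have : 0 < H.degree y₀ := by rw [hreg y₀]; exact ha
    exact (H.degree_pos_iff_exists_adj y₀).1 this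
  -- One adjacent and one non-adjacent pair are needed to realise the real values of `lam` and `mu`
  -- as cardinalities.
  obtain ⟨y₂, hy₂, hy₂'⟩ : ∃ z, y₀ ≠ z ∧ ¬ H.Adj y₀ z := by
    by_contra! hall
    have h1 : (Finset.univ : Finset V) ⊆ insert y₀ (H.neighborFinset y₀) := by
      intro z _
      by_cases hz : y₀ = z
      · simp [hz]
      · simp [hall z hz]
    have h2 := (Finset.card_le_card h1).trans (Finset.card_insert_le _ _)
    rw [SimpleGraph.card_neighborFinset_eq_degree, hreg y₀, Finset.card_univ] at h2
    omega
  refine ⟨_, _, ⟨rfl, hreg, ?_, ?_⟩, hadj y₀ y₁ hy₁, hnadj y₀ y₂ hy₂ hy₂'⟩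
  · intro y z hyz
    exact_mod_cast (hadj y z hyz).trans (hadj y₀ y₁ hy₁).symm
  · intro y z hne hyz
    exact_mod_cast (hnadj y z hne hyz).trans (hnadj y₀ y₂ hy₂ hy₂').symm

theorem connected_of_isSRGWith [Nonempty V] {H : SimpleGraph V} [DecidableRel H.Adj]
    {n a lam mu : ℕ} (h : H.IsSRGWith n a lam mu) (hmu : mu ≠ 0) : H.Connected := by
  refine SimpleGraph.connected_iff _ |>.2 ⟨fun y z => ?_, inferInstance⟩
  by_cases hyz : y = z
  · rw [hyz]
  by_cases hadj : H.Adj y z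
  · exact hadj.reachable
  have hcard := h.of_not_adj hyz hadj
  have hpos : 0 < Fintype.card (H.commonNeighbors y z) := by omega
  obtain ⟨⟨w, hw⟩⟩ := Fintype.card_pos_iff.1 hpos
  exact hw.1.reachable.trans hw.2.reachable.symm

/-- The quadratic relation only bounds the spectrum from above; the nonzero multiplicities show that
`r` and `s` really occur. -/
theorem spectrum_adjMatrix_eq [Nonempty V] {H : SimpleGraph V} [DecidableRel H.Adj] {a : ℝ}
    (hrow : ∀ y, ∑ z, H.adjMatrix ℝ y z = a) {r s : ℝ}
    (h : (H.adjMatrix ℝ - r • (1 : Matrix V V ℝ)) * (H.adjMatrix ℝ - s • (1 : Matrix V V ℝ)) *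
      centering V = 0) (hr : eigMult H r ≠ 0) (hs : eigMult H s ≠ 0) :
    spectrum ℝ (H.adjMatrix ℝ) = {a, r, s} := by
  have hmult : ∀ t, eigMult H t ≠ 0 → t ∈ spectrum ℝ (H.adjMatrix ℝ) := fun t ht => by
    rw [← Matrix.spectrum_toLin', ← Module.End.hasEigenvalue_iff_mem_spectrum,
      Module.End.hasEigenvalue_iff]
    intro hbot
    exact ht (by rw [eigMult, hbot, finrank_bot])
  ext t
  simp only [Set.mem_insert_iff, Set.mem_singleton_iff]
  constructor
  · intro ht
    obtain ⟨v, hv0, hv⟩ := mem_spectrum_iff_exists_mulVec.1 ht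
    exact eigenvalue_mem_of_mul_centering_eq_zero H.isSymm_adjMatrix hrow h hv0 hv
  · rintro (rfl | rfl | rfl)
    · refine mem_spectrum_iff_exists_mulVec.2 ⟨fun _ => 1, ?_, ?_⟩
      · intro h0
        simpa using congrFun h0 (Classical.arbitrary V)
      · ext y
        simpa [Matrix.mulVec, dotProduct] using hrow y
    · exact hmult _ hr
    · exact hmult _ hs

end Final

end DistReg

/-! ### The local graph of a tight distance-regular graph. -/

theorem theorem12p4 {X : Type*} [Fintype X] [DecidableEq X] (G : SimpleGraph X)
    [DecidableRel G.Adj] (hG : DistReg.IsDistanceRegular G) (hd : 3 ≤ G.diam)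
    (htight : DistReg.IsTight G)
    (ev : ℕ → ℝ) (hev : DistReg.IsEigenvalueSequence G ev)
    (θ θ' : ℝ) (hθ : (θ = ev 1 ∧ θ' = ev G.diam) ∨ (θ = ev G.diam ∧ θ' = ev 1))
    (σ : ℕ → ℝ) (hσ : DistReg.IsCosineSequence G θ σ)
    (ε : ℝ) (hε : ε = DistReg.auxiliaryParameter G θ θ')
    (x : X) :
    -- the denominators in the formulas below do not vanish
    (1 + σ 1 ≠ 0 ∧ σ 1 - σ 2 ≠ 0 ∧ σ 2 - σ 1 ^ 2 ≠ 0 ∧ 1 - ε * σ 1 ≠ 0) ∧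
    -- (i) strong regularity and parameters
    (∃ lam mu : ℕ,
      (DistReg.localGraph G x).IsSRGWith (DistReg.valency G) (DistReg.a G 1) lam mu ∧
      (DistReg.a G 1 : ℝ) =
        - ((1 - σ 2) * (1 + σ 1) * (1 - ε)) / ((σ 1 - σ 2) * (1 - ε * σ 1)) ∧
      (lam : ℝ) = (DistReg.a G 1 : ℝ) * (2 * σ 1 / (1 + σ 1))
        - (DistReg.a G 1 : ℝ) * ((1 - σ 1) / (1 + σ 1)) * (σ 2 / (σ 1 - σ 2))
        - (1 - σ 2) / (σ 1 - σ 2) ∧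
      (mu : ℝ) = (DistReg.a G 1 : ℝ) / (1 + σ 1) * ((σ 1 ^ 2 - σ 2) / (σ 1 - σ 2))) ∧
    -- (ii) connected and not a clique
    ((DistReg.localGraph G x).Connected ∧ DistReg.localGraph G x ≠ ⊤) ∧
    -- (iii) the distinct eigenvalues, (iv) the multiplicities
    (∃ r s : ℝ,
      r = (DistReg.a G 1 : ℝ) * σ 1 / (1 + σ 1) ∧
      s = - ((1 - σ 2) / (σ 1 - σ 2)) ∧
      ((DistReg.a G 1 : ℝ) ≠ r ∧ (DistReg.a G 1 : ℝ) ≠ s ∧ r ≠ s) ∧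
      spectrum ℝ ((DistReg.localGraph G x).adjMatrix ℝ) = {(DistReg.a G 1 : ℝ), r, s} ∧
      (DistReg.eigMult (DistReg.localGraph G x) r : ℝ) =
        (1 + σ 1) * (σ 1 - ε) / (σ 2 - σ 1 ^ 2) ∧
      (DistReg.eigMult (DistReg.localGraph G x) s : ℝ) =
        - ((1 - ε) * (1 + σ 1) * (σ 2 - ε * σ 1)) /
          ((σ 2 - σ 1 ^ 2) * (1 - ε * σ 1))) := by
  have hpar := htight.tightParameters hG hd hev hθ
  have hmem : θ ∈ spectrum ℝ (G.adjMatrix ℝ) := by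
    rw [← hev.2]
    rcases hθ with ⟨rfl, -⟩ | ⟨rfl, -⟩
    · exact ⟨1, Set.mem_Iic.2 (by omega), rfl⟩
    · exact ⟨G.diam, Set.mem_Iic.2 le_rfl, rfl⟩
  have hcard := DistReg.card_neighborSet hG (by omega) x
  have hcard' : (Fintype.card (G.neighborSet x) : ℝ) = DistReg.valency G := by
    exact_mod_cast hcard
  have hkpos : 0 < DistReg.valency G := by exact_mod_cast hpar.k_pos
  have hne : Nonempty (G.neighborSet x) := by
    rw [← Fintype.card_pos_iff, hcard]
    exact hkpos
  obtain ⟨⟨y, hxy⟩⟩ := id hne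
  obtain ⟨h1, h2⟩ := hσ.eq hG (by omega) hxy hmem
  rw [DistReg.auxiliaryParameter] at hε
  have hden := hpar.denominators_ne_zero h1 h2 hε
  obtain ⟨d1, d2, d3, d4⟩ := id hden
  set r : ℝ := (DistReg.a G 1 : ℝ) * θ / (DistReg.valency G + θ) with hr
  set s : ℝ := -((DistReg.valency G + θ - DistReg.a G 1) / (1 + θ)) with hs
  have hr' := hpar.r_eq h1
  have hs' := hpar.s_eq h1 h2
  have hzero := htight.localGraph_mul_centering_eq_zero hG hd hev hθ x hr hs
  have hzero' : ((DistReg.localGraph G x).adjMatrix ℝ -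
        s • (1 : Matrix (G.neighborSet x) (G.neighborSet x) ℝ)) *
      ((DistReg.localGraph G x).adjMatrix ℝ -
        r • (1 : Matrix (G.neighborSet x) (G.neighborSet x) ℝ)) *
      DistReg.centering (G.neighborSet x) = 0 := by
    rw [← hzero]
    congr 1
    simp only [Matrix.sub_mul, Matrix.mul_sub, Matrix.smul_mul, Matrix.mul_smul, Matrix.one_mul,
      Matrix.mul_one, smul_sub, smul_smul, mul_comm r s]
    abel
  have hreg := DistReg.localGraph_isRegularOfDegree hG (by omega) x
  have hrow := DistReg.sum_adjMatrix_localGraph hG (by omega) x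
  have hk : DistReg.valency G = 1 + DistReg.a G 1 + DistReg.b G 1 := by
    exact_mod_cast hpar.k_eq
  have hapos : 0 < DistReg.a G 1 := by exact_mod_cast hpar.a_pos
  have hbpos := DistReg.b_one_pos hG hd
  obtain ⟨lam, mu, hsrg, hlam, hmu⟩ :=
    DistReg.isSRGWith_of_mul_centering_eq_zero hreg hapos (by omega) hzero
  rw [hcard] at hsrg
  have hmu' : (mu : ℝ) = (DistReg.a G 1 : ℝ) / (1 + σ 1) * ((σ 1 ^ 2 - σ 2) / (σ 1 - σ 2)) := by
    rw [hmu, hr, hs, ← hr', ← hs']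
    field_simp
    ring
  -- The factor `σ 1 ^ 2 - σ 2` is nonzero because neither factor of the tight product vanishes; a
  -- nonzero `mu` gives connectedness.
  have hmu0 : mu ≠ 0 := by
    intro h0
    rw [h0, Nat.cast_zero] at hmu'
    refine mul_ne_zero (div_ne_zero hpar.a_pos.ne' d1) (div_ne_zero ?_ d2) hmu'.symm
    rw [← neg_sub, neg_ne_zero]
    exact d3
  have hmr : (DistReg.eigMult (DistReg.localGraph G x) r : ℝ) =
      (1 + σ 1) * (σ 1 - ε) / (σ 2 - σ 1 ^ 2) := by
    rw [← hpar.mult_r_eq h1 h2 hε hr hs, ← hcard']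
    exact DistReg.finrank_eigenspace_eq (SimpleGraph.isSymm_adjMatrix _) hrow
      (SimpleGraph.trace_adjMatrix _ _) hpar.r_ne_s hpar.a_ne_r.symm hzero
  have hms : (DistReg.eigMult (DistReg.localGraph G x) s : ℝ) =
      -(r * ((DistReg.valency G : ℝ) - 1) + DistReg.a G 1) / (s - r) := by
    rw [← hcard']
    exact DistReg.finrank_eigenspace_eq (SimpleGraph.isSymm_adjMatrix _) hrow
      (SimpleGraph.trace_adjMatrix _ _) hpar.r_ne_s.symm hpar.a_ne_s.symm hzero'
  refine ⟨hden, ⟨lam, mu, hsrg, hpar.a_eq h1 h2 hε, ?_, hmu'⟩,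
    ⟨DistReg.connected_of_isSRGWith hsrg hmu0, ?_⟩,
    r, s, hr'.symm, hs'.symm, ⟨hpar.a_ne_r, hpar.a_ne_s, hpar.r_ne_s⟩, ?_, hmr,
    hms.trans (hpar.mult_s_eq h1 h2 hε hr hs)⟩
  · rw [hlam, hr, hs, ← hr', ← hs']
    field_simp
    ring
  -- A clique would have valency `k - 1`, but `a₁ = k - 1 - b₁` with `b₁ > 0`.
  · intro htop
    have h3 := hreg ⟨y, hxy⟩
    have h4 : (DistReg.localGraph G x).degree ⟨y, hxy⟩ = Fintype.card (G.neighborSet x) - 1 := by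
      rw [← SimpleGraph.card_neighborFinset_eq_degree, ← Finset.card_univ,
        ← Finset.card_erase_of_mem (Finset.mem_univ (⟨y, hxy⟩ : G.neighborSet x))]
      congr 1
      ext z
      rw [SimpleGraph.mem_neighborFinset, htop, SimpleGraph.top_adj, Finset.mem_erase, ne_comm]
      simp
    omega
  · refine DistReg.spectrum_adjMatrix_eq hrow hzero ?_ ?_
    · intro h0
      rw [h0, Nat.cast_zero] at hmr
      exact hpar.mult_r_ne_zero h1 h2 hε hmr.symm
    · intro h0
      rw [h0, Nat.cast_zero] at hms
      exact hpar.mult_s_ne_zero hr hs hms.symm
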